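/- Let $\mathbb T=\mathbb R/\mathbb Z$ with its normalized Haar measure, and for $p\ge 2$ put $s_p^\star=\frac14$ if $p\le 4$ and $s_p^\star=\frac12-\frac1p$ if $p>4$. For $s>\frac14$ let $$R_s(x)=\sum_{n=1}^{\infty}\frac{e^{2\pi i n^2x}}{n^{2s}}\in L^2(\mathbb T),$$ where the series converges in $L^2(\mathbb T)$. For $f\in L^2(\mathbb T)$ with Fourier series $f(x)=\sum_{n\in\mathbb Z}a_n e^{2\pi i n x}$ and for $N\in\mathbb N$ let $f_{\ge N}(x)=\sum_{|n|\ge N}a_n e^{2\pi i n x}$ be its high-pass filter (the series again converging in $L^2(\mathbb T)$), and let $$F_{f,p}(N)=\frac{\|f_{\ge N}\|_{L^p(\mathbb T)}^p}{\|f_{\ge N}\|_{L^2(\mathbb T)}^p}$$ be the $p$-flatness of $f$ in the sense of high-pass filters. Theorem. Let $2\le p<\infty$ and $s>s_p^\star$. Then $R_s$ and all of its high-pass filters $(R_s)_{\ge N}$, $N\in\mathbb N$, belong to $L^p(\mathbb T)$, and, as $N\to\infty$ through the natural numbers, $$F_{R_s,p}(N)\simeq_{s,p}\begin{cases}1, &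 p<4,\\ \log N, & p=4,\\ N^{p/4-1}, & p>4.\end{cases}$$ Here $A(N)\simeq_{s,p}B(N)$ as $N\to\infty$ means that there are constants $c,C>0$, depending only on $s$ and $p$, such that $c\,B(N)\le A(N)\le C\,B(N)$ for all sufficiently large $N$. -/

import Mathlib

open MeasureTheory AddCircle Filter Asymptotics

noncomputable section

/-- The space `L²(𝕋)` of the torus `𝕋 = ℝ / ℤ` with its Haar probability measure. -/
abbrev L2Torus : Type := Lp ℂ 2 (haarAddCircle : Measure (AddCircle (1 : ℝ)))

/-- The threshold `s_p^⋆`. -/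
def sStar (p : ℝ) : ℝ := if p ≤ 4 then 1 / 4 else 1 / 2 - 1 / p

/-- The generalized Riemann function `R_s(x) = ∑_{n ≥ 1} e^{2π i n² x} / n^{2s}`, the sum of the
series in `L²(𝕋)`. As the characters are orthonormal, the series converges there (unconditionally)
for every `s > 1/4`. The index `n` below is `n - 1` in the displayed series. -/
def riemannFn (s : ℝ) : L2Torus :=
  ∑' n : ℕ, (((1 / ((n : ℝ) + 1) ^ (2 * s) : ℝ)) : ℂ) •
    (fourierLp 2 (((n : ℤ) + 1) ^ 2) : L2Torus)

/-- The high-pass filter `f_{≥ N}(x) = ∑_{|n| ≥ N} a_n e^{2π i n x}` of `f ∈ L²(𝕋)` with Fourier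
coefficients `a_n`; the series converges in `L²(𝕋)`. -/
def highPass (f : L2Torus) (N : ℕ) : L2Torus :=
  ∑' n : ℤ, if (N : ℤ) ≤ |n| then fourierCoeff f n • (fourierLp 2 n : L2Torus) else 0

/-- The `L^p(𝕋)` norm of `g`, as a real number; it is meaningful when `g ∈ L^p(𝕋)`. -/
def normLp (p : ℝ) (g : AddCircle (1 : ℝ) → ℂ) : ℝ :=
  (eLpNorm g (ENNReal.ofReal p) haarAddCircle).toReal

/-- The `p`-flatness of `f` at scale `N⁻¹` in the sense of high-pass filters,
`F_{f,p}(N) = ‖f_{≥ N}‖_p^p / ‖f_{≥ N}‖_2^p`. -/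
def flatnessHP (f : L2Torus) (p : ℝ) (N : ℕ) : ℝ :=
  normLp p (highPass f N) ^ p / normLp 2 (highPass f N) ^ p

end

noncomputable section

/-! ### Weyl differencing with smooth weights -/

/-! Write `M = cutoff N`, so that `N ≤ M² ≤ 4N` for `N ≥ 1`; the filter keeps the terms with `n ≥
M`. Its `L^p` norm has the order of `M^(-2s)` times that of a quadratic Weyl sum of length `M`:
`M^(1/2)` for `p < 4`, `M^(1/2) (log M)^(1/4)` for `p = 4`, `M^(1-2/p)` for `p > 4`. Dividing by the
`L²` size `M^(1/2-2s)` and raising to the power `p` gives the three regimes.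

Upper bounds. Weyl differencing with a smooth weight (`IsBump.norm_sq_sum_le`) and one Dirichlet
approximation (`exists_rat_sum_le`) give, without logarithmic loss, `|S(x)|² ≲ 1 / (q (L⁻² + ‖x -
a/q‖))` for some `q ≤ 4L`. For `p > 2`, summing the power `p/2` of this over all `a/q` and
integrating yields `L^(p-2) ∑_{q ≤ 4L} q^(1-p/2)` (`IsBump.Lp_norm_rpow_le`); the exponent `1 - p/2`
crosses `-1` at `p = 4`. Sharp cutoffs are telescoped into dyadic bumps
(`norm_sum_Ioc_le_sum_dyadic`), and Abel summation on dyadic blocks inserts the coefficients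
(`exists_norm_sum_coef_le`), where `s > s_p^⋆` makes the blocks decay geometrically up to a linear
factor. The resulting tail bounds also give convergence in `L^p` (`memLp_highPass_and_tendsto`).

Lower bounds. For `p < 4`, monotonicity of `L^p` norms on a probability space suffices. For `p = 4`,
the fourth moment counts solutions of `a² + b² = c² + d²`, and an explicit family supplies the
logarithm (`sum_totient_mul_le_card_quadruples`). For `p > 4`, the peak at `x = 0` dominates and is
detected by pairing with the square of a Dirichlet kernel (`sum_coef_le_integral`). Parseval handles
`L²`. -/

lemma four_mul_norm_le_norm_fourier_sub_one (k : ℤ) (x : AddCircle (1 : ℝ)) :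
    4 * ‖k • x‖ ≤ ‖fourier k x - 1‖ := by
  have key : ∀ y : AddCircle (1 : ℝ), 4 * ‖y‖ ≤ ‖fourier 1 y - 1‖ := by
    intro y
    obtain ⟨t, rfl⟩ := QuotientAddGroup.mk_surjective y
    have h1 : ((t - round t : ℝ) : AddCircle (1 : ℝ)) = (t : AddCircle (1 : ℝ)) := by
      rw [AddCircle.coe_sub]
      have : ((round t : ℝ) : AddCircle (1 : ℝ)) = 0 := by
        rw [AddCircle.coe_eq_zero_iff]
        exact ⟨round t, by simp⟩
      rw [this, sub_zero]
    change 4 * ‖(t : AddCircle (1 : ℝ))‖ ≤ ‖fourier 1 (t : AddCircle (1 : ℝ)) - 1‖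
    rw [← h1]
    set u : ℝ := t - round t with hu
    have hu2 : |u| ≤ 1 / 2 := abs_sub_round t
    have hn : ‖(u : AddCircle (1 : ℝ))‖ = |u| :=
      (AddCircle.norm_coe_eq_abs_iff 1 one_ne_zero).2 (by simpa using hu2)
    rw [hn, fourier_coe_apply]
    have h2 : (2 * Real.pi * Complex.I * (1 : ℤ) * u / (1 : ℝ) : ℂ)
        = Complex.I * ((2 * Real.pi * u : ℝ) : ℂ) := by
      push_cast; ring
    rw [h2, Complex.norm_exp_I_mul_ofReal_sub_one, norm_mul, Real.norm_eq_abs, Real.norm_eq_abs,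
      abs_of_pos (by norm_num : (0 : ℝ) < 2)]
    have h3 : 2 * Real.pi * u / 2 = Real.pi * u := by ring
    have hpi := Real.pi_pos
    -- Jordan's inequality `|sin y| ≥ 2|y|/π`, applicable because `u` is the representative with
    -- `|u| ≤ 1/2`.
    have h4 := Real.mul_abs_le_abs_sin (x := Real.pi * u) (by
      rw [abs_mul, abs_of_pos hpi]; nlinarith)
    rw [h3]
    rw [abs_mul, abs_of_pos hpi] at h4
    have : 2 / Real.pi * (Real.pi * |u|) = 2 * |u| := by field_simp
    linarith
  have := key (k • x)
  rwa [fourier_apply, one_smul, ← fourier_apply] at this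

/-- Summation by parts twice: a smooth weight has small exponential sums away from `1`. -/
lemma norm_sum_mul_zpow_le {g : ℤ → ℝ} {S : Finset ℤ} (hg : ∀ n, g n ≠ 0 → n ∈ S) {D : ℝ}
    (hD : ∀ J : Finset ℤ, ∑ n ∈ J, |g (n + 2) - 2 * g (n + 1) + g n| ≤ D)
    {z : ℂ} (hz : ‖z‖ = 1) :
    ‖∑ n ∈ S, (g n : ℂ) * z ^ n‖ * ‖z - 1‖ ^ 2 ≤ D := by
  have hz0 : z ≠ 0 := by rintro rfl; simp at hz
  set Z := ∑ n ∈ S, (g n : ℂ) * z ^ n with hZ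
  have h0 : HasSum (fun n : ℤ => (g n : ℂ) * z ^ n) Z := by
    apply hasSum_sum_of_ne_finset_zero
    intro n hn
    have : g n = 0 := by
      by_contra h
      exact hn (hg n h)
    simp [this]
  have h1 : HasSum (fun n : ℤ => (g (n + 1) : ℂ) * z ^ (n + 1)) Z :=
    (Equiv.addRight (1 : ℤ)).hasSum_iff (f := fun n : ℤ => (g n : ℂ) * z ^ n) |>.2 h0
  have h2 : HasSum (fun n : ℤ => (g (n + 2) : ℂ) * z ^ (n + 2)) Z :=
    (Equiv.addRight (2 : ℤ)).hasSum_iff (f := fun n : ℤ => (g n : ℂ) * z ^ n) |>.2 h0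
  -- The three shifts of one sum combine to `Z (z - 1)²`, while termwise they form the second
  -- difference of `g` times `z ^ (n + 2)`.
  have h3 := (h2.sub (h1.mul_left (2 * z))).add (h0.mul_left (z ^ 2))
  have h4 : Z - 2 * z * Z + z ^ 2 * Z = Z * (z - 1) ^ 2 := by ring
  rw [h4] at h3
  have h5 : ∀ J : Finset ℤ, ‖∑ n ∈ J, ((g (n + 2) : ℂ) * z ^ (n + 2)
      - 2 * z * ((g (n + 1) : ℂ) * z ^ (n + 1)) + z ^ 2 * ((g n : ℂ) * z ^ n))‖ ≤ D := by
    intro J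
    refine (norm_sum_le _ _).trans (le_trans (Finset.sum_le_sum fun n _ => ?_) (hD J))
    have : (g (n + 2) : ℂ) * z ^ (n + 2)
      - 2 * z * ((g (n + 1) : ℂ) * z ^ (n + 1)) + z ^ 2 * ((g n : ℂ) * z ^ n)
      = ((g (n + 2) - 2 * g (n + 1) + g n : ℝ) : ℂ) * z ^ (n + 2) := by
      rw [zpow_add₀ hz0, zpow_add₀ hz0, zpow_one]
      push_cast
      rw [show z ^ (2 : ℤ) = z ^ 2 from zpow_ofNat z 2]
      ring
    rw [this, norm_mul, norm_zpow, hz, one_zpow, mul_one, Complex.norm_real, Real.norm_eq_abs]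
  have h6 : ‖Z * (z - 1) ^ 2‖ ≤ D := le_of_tendsto h3.norm (Eventually.of_forall h5)
  rwa [norm_mul, norm_pow] at h6

/-- A weight on `ℤ` which lives on an interval of length `L` and varies at scale `L`. -/
structure IsBump (w : ℤ → ℝ) (a : ℤ) (L : ℕ) : Prop where
  supp : ∀ n, w n ≠ 0 → n ∈ Finset.Ioo a (a + L)
  abs_le : ∀ n, |w n| ≤ 1
  diff_le : ∀ n, |w (n + 1) - w n| ≤ 8 / L
  second : ∀ J : Finset ℤ, ∑ n ∈ J, |w (n + 2) - 2 * w (n + 1) + w n| ≤ 8 / L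

/-- Discrete Leibniz rule. The terms carrying a second difference use its `ℓ¹` bound; the product of
first differences is `O(L⁻²)` pointwise and lives on `L` integers. -/
lemma IsBump.second_mul {w : ℤ → ℝ} {a : ℤ} {L : ℕ} (hw : IsBump w a L) (hL : 0 < L) (h : ℤ)
    (J : Finset ℤ) :
    ∑ n ∈ J, |w (n + 2) * w (n + 2 + h) - 2 * (w (n + 1) * w (n + 1 + h)) + w n * w (n + h)|
      ≤ 272 / L := by
  have hL' : (0 : ℝ) < L := by exact_mod_cast hL
  set d : ℤ → ℝ := fun n => w (n + 1) - w n with hd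
  set dd : ℤ → ℝ := fun n => w (n + 2) - 2 * w (n + 1) + w n with hdd
  have hid : ∀ n, w (n + 2) * w (n + 2 + h) - 2 * (w (n + 1) * w (n + 1 + h)) + w n * w (n + h)
      = w (n + 2) * dd (n + h) + (d (n + 1) + d (n + 1)) * d (n + h) + dd n * w (n + h) := by
    intro n
    simp only [hd, hdd]
    rw [show n + 1 + 1 = n + 2 by ring, show n + h + 2 = n + 2 + h by ring,
      show n + h + 1 = n + 1 + h by ring]
    ring
  have hA : ∑ n ∈ J, |w (n + 2) * dd (n + h)| ≤ 8 / L := by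
    refine le_trans (Finset.sum_le_sum (g := fun n => |dd (n + h)|) fun n _ => ?_) ?_
    · rw [abs_mul]
      exact mul_le_of_le_one_left (abs_nonneg _) (hw.abs_le _)
    · have := hw.second (J.map (Equiv.addRight h).toEmbedding)
      rw [Finset.sum_map] at this
      exact this
  have hC : ∑ n ∈ J, |dd n * w (n + h)| ≤ 8 / L := by
    refine le_trans (Finset.sum_le_sum (g := fun n => |dd n|) fun n _ => ?_) (hw.second J)
    rw [abs_mul]
    exact mul_le_of_le_one_right (abs_nonneg _) (hw.abs_le _)
  have hB : ∑ n ∈ J, |(d (n + 1) + d (n + 1)) * d (n + h)| ≤ 256 / L := by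
    have hterm : ∀ n, |(d (n + 1) + d (n + 1)) * d (n + h)| ≤ 128 / (L * L) := by
      intro n
      rw [abs_mul]
      have h1 := (abs_add_le (d (n + 1)) (d (n + 1))).trans
        (add_le_add (hw.diff_le (n + 1)) (hw.diff_le (n + 1)))
      have h2 := hw.diff_le (n + h)
      calc |d (n + 1) + d (n + 1)| * |d (n + h)| ≤ (8 / L + 8 / L) * (8 / L) :=
            mul_le_mul h1 h2 (abs_nonneg _) (by positivity)
        _ = 128 / (L * L) := by field_simp; norm_num
    have hzero : ∀ n, n ∉ Finset.Ico (a - h) (a + L - h) →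
        |(d (n + 1) + d (n + 1)) * d (n + h)| = 0 := by
      intro n hn
      have e1 : w (n + h + 1) = 0 := by
        by_contra hc
        have := hw.supp _ hc
        simp only [Finset.mem_Ioo, Finset.mem_Ico] at this hn
        omega
      have e2 : w (n + h) = 0 := by
        by_contra hc
        have := hw.supp _ hc
        simp only [Finset.mem_Ioo, Finset.mem_Ico] at this hn
        omega
      simp [hd, e1, e2]
    calc ∑ n ∈ J, |(d (n + 1) + d (n + 1)) * d (n + h)|
        = ∑ n ∈ J ∩ Finset.Ico (a - h) (a + L - h), |(d (n + 1) + d (n + 1)) * d (n + h)| := by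
          symm
          apply Finset.sum_subset Finset.inter_subset_left
          intro n hn hn'
          apply hzero
          intro hc
          exact hn' (Finset.mem_inter.2 ⟨hn, hc⟩)
      _ ≤ ∑ n ∈ J ∩ Finset.Ico (a - h) (a + L - h), (128 / (L * L) : ℝ) :=
          Finset.sum_le_sum fun n _ => hterm n
      _ ≤ ∑ n ∈ Finset.Ico (a - h) (a + L - h), (128 / (L * L) : ℝ) :=
          Finset.sum_le_sum_of_subset_of_nonneg Finset.inter_subset_right
            (fun _ _ _ => by positivity)
      _ = L * (128 / (L * L)) := by
          rw [Finset.sum_const, Int.card_Ico, nsmul_eq_mul]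
          congr 2
          omega
      _ ≤ 256 / L := by
          rw [show (L : ℝ) * (128 / (L * L)) = 128 / L by field_simp]
          gcongr; norm_num
  calc _ ≤ ∑ n ∈ J, (|w (n + 2) * dd (n + h)| + |(d (n + 1) + d (n + 1)) * d (n + h)|
        + |dd n * w (n + h)|) := by
        refine Finset.sum_le_sum fun n _ => ?_
        rw [hid]
        exact (abs_add_le _ _).trans (by gcongr; exact abs_add_le _ _)
    _ ≤ 8 / L + 256 / L + 8 / L := by
        rw [Finset.sum_add_distrib, Finset.sum_add_distrib]
        gcongr
    _ = 272 / L := by ring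

/-- Weyl differencing: `n² - (n + h)²` is linear in `n`, so each correlation is a linear exponential
sum of frequency `-2h` with weight `w n * w (n + h)`. It is at most `L` trivially, and small away
from `2hx = 0` by double summation by parts. -/
lemma IsBump.norm_sq_sum_le {w : ℤ → ℝ} {a : ℤ} {L : ℕ} (hw : IsBump w a L) (hL : 0 < L)
    (x : AddCircle (1 : ℝ)) :
    ‖∑ n ∈ Finset.Ioo a (a + L), (w n : ℂ) * fourier (n ^ 2) x‖ ^ 2 ≤
      ∑ h ∈ Finset.Ioo (-L : ℤ) L, 18 * (L / (1 + (L * ‖(2 * h) • x‖) ^ 2)) := by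
  have hL' : (0 : ℝ) < L := by exact_mod_cast hL
  set I := Finset.Ioo a (a + L) with hI
  set F : ℤ → ℂ := fun n => (w n : ℂ) * fourier (n ^ 2) x with hF
  have hw0 : ∀ n, n ∉ I → w n = 0 := fun n hn => by
    by_contra hc
    exact hn (hw.supp _ hc)
  have hnorm : ∀ k : ℤ, ‖(fourier k x : ℂ)‖ = 1 := fun k => by
    rw [fourier_apply]; exact Circle.norm_coe _
  have sum_conj_eq : ∀ n ∈ I, ∑ m ∈ I, (starRingEnd ℂ) (F m)
      = ∑ h ∈ Finset.Ioo (-L : ℤ) L, (starRingEnd ℂ) (F (n + h)) := by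
    intro n hn
    have e : ∑ h ∈ Finset.Ioo (-L : ℤ) L, (starRingEnd ℂ) (F (n + h))
        = ∑ m ∈ (Finset.Ioo (-L : ℤ) L).map (Equiv.addLeft n).toEmbedding,
          (starRingEnd ℂ) (F m) := by
      rw [Finset.sum_map]; rfl
    rw [e]
    apply Finset.sum_subset
    · intro m hm
      simp only [hI, Finset.mem_Ioo] at hn hm
      rw [Finset.mem_map]
      refine ⟨m - n, ?_, by simp⟩
      rw [Finset.mem_Ioo]
      omega
    · intro m _ hm
      simp [hF, hw0 m hm]
  have norm_sq_le : (‖∑ n ∈ I, F n‖ ^ 2 : ℝ) ≤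
      ∑ h ∈ Finset.Ioo (-L : ℤ) L, ‖∑ n ∈ I, F n * (starRingEnd ℂ) (F (n + h))‖ := by
    have e1 : ((‖∑ n ∈ I, F n‖ ^ 2 : ℝ) : ℂ)
        = ∑ h ∈ Finset.Ioo (-L : ℤ) L, ∑ n ∈ I, F n * (starRingEnd ℂ) (F (n + h)) := by
      push_cast
      rw [← Complex.mul_conj', map_sum, Finset.sum_mul, Finset.sum_comm]
      refine Finset.sum_congr rfl fun n hn => ?_
      rw [sum_conj_eq n hn, Finset.mul_sum]
    calc (‖∑ n ∈ I, F n‖ ^ 2 : ℝ) = ‖((‖∑ n ∈ I, F n‖ ^ 2 : ℝ) : ℂ)‖ := by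
          rw [Complex.norm_real, Real.norm_eq_abs, abs_of_nonneg (by positivity)]
      _ ≤ _ := by
          rw [e1]; exact norm_sum_le _ _
  refine norm_sq_le.trans (Finset.sum_le_sum fun h _ => ?_)
  set g : ℤ → ℝ := fun n => w n * w (n + h) with hg
  have hgS : ∀ n, g n ≠ 0 → n ∈ I := fun n hn => by
    apply hw.supp
    intro hc
    simp [hg, hc] at hn
  set z : ℂ := fourier (-(2 * h)) x with hz
  have hz1 : ‖z‖ = 1 := hnorm _
  have hzpow : ∀ n : ℤ, z ^ n = fourier (-(2 * h) * n) x := by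
    intro n
    rw [hz, fourier_apply, fourier_apply, ← Circle.coe_zpow, ← AddCircle.toCircle_zsmul, smul_smul,
      mul_comm]
  have e2 : ∀ n, F n * (starRingEnd ℂ) (F (n + h))
      = (starRingEnd ℂ) (fourier (h ^ 2) x) * ((g n : ℂ) * z ^ n) := by
    intro n
    simp only [hF, hg]
    rw [hzpow, map_mul, Complex.conj_ofReal, ← fourier_neg, ← fourier_neg]
    have : (fourier (n ^ 2) x : ℂ) * fourier (-(n + h) ^ 2) x
        = fourier (-h ^ 2) x * fourier (-(2 * h) * n) x := by
      rw [← fourier_add, ← fourier_add]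
      congr 1
      ring_nf
    push_cast
    linear_combination (w n : ℂ) * (w (n + h) : ℂ) * this
  have e3 : ‖∑ n ∈ I, F n * (starRingEnd ℂ) (F (n + h))‖ = ‖∑ n ∈ I, (g n : ℂ) * z ^ n‖ := by
    simp_rw [e2]
    rw [← Finset.mul_sum, norm_mul, RCLike.norm_conj, hnorm, one_mul]
  rw [e3]
  set X := ‖∑ n ∈ I, (g n : ℂ) * z ^ n‖ with hX
  have hX1 : X ≤ L := by
    calc X ≤ ∑ n ∈ I, (1 : ℝ) := by
          refine (norm_sum_le _ _).trans (Finset.sum_le_sum fun n _ => ?_)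
          rw [norm_mul, norm_zpow, hz1, one_zpow, mul_one, Complex.norm_real, Real.norm_eq_abs, hg,
            abs_mul]
          exact mul_le_one₀ (hw.abs_le _) (abs_nonneg _) (hw.abs_le _)
      _ ≤ L := by
          rw [Finset.sum_const, nsmul_eq_mul, mul_one, hI, Int.card_Ioo]
          have : (a + L - a - 1).toNat ≤ L := by omega
          exact_mod_cast this
  have hX2 : X * ‖z - 1‖ ^ 2 ≤ 272 / L := by
    apply norm_sum_mul_zpow_le hgS _ hz1
    intro J
    exact hw.second_mul hL h J
  have hz4 : 4 * ‖(2 * h) • x‖ ≤ ‖z - 1‖ := by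
    have := four_mul_norm_le_norm_fourier_sub_one (-(2 * h)) x
    rwa [neg_smul, norm_neg] at this
  have hX0 : 0 ≤ X := norm_nonneg _
  have hX3 : X * (16 * ‖(2 * h) • x‖ ^ 2) ≤ 272 / L := by
    refine le_trans (mul_le_mul_of_nonneg_left ?_ hX0) hX2
    calc 16 * ‖(2 * h) • x‖ ^ 2 = (4 * ‖(2 * h) • x‖) ^ 2 := by ring
      _ ≤ _ := by gcongr
  -- The constant is `18 = 1 + 17`: the trivial bound contributes `1`, the differenced one `17 = 272
  -- / 16`.
  rw [← mul_div_assoc, le_div_iff₀ (by positivity)]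
  have hX4 : X * ((L : ℝ) * ‖(2 * h) • x‖) ^ 2 ≤ 17 * (L : ℝ) := by
    calc X * ((L : ℝ) * ‖(2 * h) • x‖) ^ 2
        = X * (16 * ‖(2 * h) • x‖ ^ 2) * ((L : ℝ) ^ 2 / 16) := by ring
      _ ≤ 272 / L * ((L : ℝ) ^ 2 / 16) := by gcongr
      _ = 17 * (L : ℝ) := by field_simp; norm_num
  nlinarith

/-! ### Rational approximation -/

/-- A Riemann sum of mesh `c` for `1 / (1 + t²)`, hence bounded uniformly in `c`; the comparison
with `2 / (1 + t)²` telescopes. -/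
lemma mul_sum_inv_one_add_sq_le {c : ℝ} (hc : 0 ≤ c) (U : ℕ) :
    c * ∑ u ∈ Finset.range U, 1 / (1 + (c * (u + 1)) ^ 2) ≤ 2 := by
  suffices h : c * ∑ u ∈ Finset.range U, 1 / (1 + (c * (u + 1)) ^ 2) ≤ 2 - 2 / (1 + c * U) by
    have : 0 ≤ 2 / (1 + c * U) := by positivity
    linarith
  induction U with
  | zero => simp
  | succ U ih =>
    rw [Finset.sum_range_succ, mul_add]
    have h1 : c * (1 / (1 + (c * (U + 1)) ^ 2)) ≤ 2 / (1 + c * U) - 2 / (1 + c * (U + 1)) := by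
      have h2 : 2 / (1 + c * U) - 2 / (1 + c * (U + 1))
          = 2 * c / ((1 + c * U) * (1 + c * (U + 1))) := by
        field_simp; ring
      rw [h2, mul_one_div, div_le_div_iff₀ (by positivity) (by positivity)]
      have h3 : (1 + c * U) * (1 + c * (U + 1)) ≤ 2 * (1 + (c * (U + 1)) ^ 2) := by
        nlinarith [sq_nonneg (1 - c * (U + 1)), mul_nonneg hc (by positivity : (0 : ℝ) ≤ U + 1)]
      nlinarith
    push_cast
    linarith

lemma sum_range_one_div_sq_le (n : ℕ) : ∑ r ∈ Finset.range n, 1 / ((r : ℝ) + 1) ^ 2 ≤ 4 := by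
  have h := mul_sum_inv_one_add_sq_le zero_le_one n
  rw [one_mul] at h
  calc ∑ r ∈ Finset.range n, 1 / ((r : ℝ) + 1) ^ 2
      ≤ ∑ r ∈ Finset.range n, 2 * (1 / (1 + (1 * ((r : ℝ) + 1)) ^ 2)) := by
        refine Finset.sum_le_sum fun r _ => ?_
        rw [mul_one_div, div_le_div_iff₀ (by positivity) (by positivity)]
        nlinarith [(Nat.cast_nonneg r : (0 : ℝ) ≤ r)]
    _ ≤ 4 := by
        rw [← Finset.mul_sum]; linarith

lemma sum_zmod_eq_sum_range {M : Type*} [AddCommMonoid M] (q : ℕ) [NeZero q] (f : ZMod q → M) :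
    ∑ z, f z = ∑ r ∈ Finset.range q, f (r : ZMod q) := by
  obtain ⟨k, rfl⟩ := Nat.exists_eq_succ_of_ne_zero (NeZero.ne q)
  have h := Fin.sum_univ_eq_sum_range (fun r : ℕ => f ((r : ZMod (k + 1)))) (k + 1)
  refine Eq.trans (Finset.sum_congr rfl fun z _ => ?_) h
  congr 1
  exact (Fin.cast_val_eq_self z).symm

/-- The point `r/q` lies at distance `min r (q - r) / q` from `0`, so two copies of `∑ q² / r²`
majorise the sum. The zero residue contributes `0⁻¹ = 0`. -/
lemma sum_zmod_inv_norm_sq_le (q : ℕ) [NeZero q] :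
    ∑ z : ZMod q, (‖ZMod.toAddCircle z‖ ^ 2)⁻¹ ≤ 8 * (q : ℝ) ^ 2 := by
  have hq : 0 < q := Nat.pos_of_ne_zero (NeZero.ne q)
  have hq' : (0 : ℝ) < q := by exact_mod_cast hq
  have hterm : ∀ r ∈ Finset.range (q - 1), (‖ZMod.toAddCircle ((r + 1 : ℕ) : ZMod q)‖ ^ 2)⁻¹
      ≤ (q : ℝ) ^ 2 * (1 / ((r : ℝ) + 1) ^ 2) + (q : ℝ) ^ 2 * (1 / (((q - 1 - 1 - r : ℕ) : ℝ) + 1) ^ 2) := by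
    intro r hr
    rw [Finset.mem_range] at hr
    rw [ZMod.toAddCircle_natCast]
    have h1 := AddCircle.norm_div_natCast (p := (1 : ℝ)) (m := r + 1) (n := q)
    rw [mul_one, Nat.mod_eq_of_lt (by omega : r + 1 < q), one_mul] at h1
    rw [h1]
    have h2 : ((q - 1 - 1 - r : ℕ) : ℝ) + 1 = (q - (r + 1) : ℕ) := by
      rw [show q - (r + 1) = (q - 1 - 1 - r) + 1 by omega]; push_cast; ring
    rw [h2]
    rcases min_choice (r + 1) (q - (r + 1)) with h | h <;> rw [h]
    · rw [div_pow, inv_div]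
      have : (0 : ℝ) ≤ (q : ℝ) ^ 2 * (1 / (((q - (r + 1) : ℕ) : ℝ)) ^ 2) := by positivity
      push_cast
      rw [mul_one_div]
      linarith
    · rw [div_pow, inv_div]
      have : (0 : ℝ) ≤ (q : ℝ) ^ 2 * (1 / ((r : ℝ) + 1) ^ 2) := by positivity
      rw [mul_one_div (q ^ 2 : ℝ) (((q - (r + 1) : ℕ) : ℝ) ^ 2)]
      linarith
  rw [sum_zmod_eq_sum_range]
  obtain ⟨k, rfl⟩ := Nat.exists_eq_succ_of_ne_zero (NeZero.ne q)
  rw [Nat.succ_eq_add_one] at *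
  rw [Finset.sum_range_succ', show k + 1 - 1 = k by omega] at *
  calc _ ≤ ∑ r ∈ Finset.range k, (((k + 1 : ℕ) : ℝ) ^ 2 * (1 / ((r : ℝ) + 1) ^ 2)
        + ((k + 1 : ℕ) : ℝ) ^ 2 * (1 / (((k - 1 - r : ℕ) : ℝ) + 1) ^ 2)) + 0 := by
        gcongr with r hr
        · exact hterm r hr
        · simp
    _ ≤ 8 * ((k + 1 : ℕ) : ℝ) ^ 2 := by
        rw [add_zero, Finset.sum_add_distrib, ← Finset.mul_sum, ← Finset.mul_sum]
        rw [Finset.sum_range_reflect (fun r : ℕ => 1 / ((r : ℝ) + 1) ^ 2) k]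
        have := sum_range_one_div_sq_le k
        nlinarith [sq_nonneg (((k + 1 : ℕ) : ℝ))]

lemma sum_range_mul_zmod (q B : ℕ) [NeZero q] (f : ZMod q → ℝ) :
    ∑ h ∈ Finset.range (q * B), f (h : ZMod q) = B * ∑ z, f z := by
  induction B with
  | zero => simp
  | succ B ih =>
    rw [Nat.mul_succ, Finset.sum_range_add, ih, sum_zmod_eq_sum_range]
    push_cast
    simp only [CharP.cast_eq_zero, zero_mul, zero_add]
    ring

/-- Odd indices may be added because `f` is nonnegative; afterwards the parity of the denominator
`q` plays no role. -/
lemma sum_Ioo_neg_le {f : ℤ → ℝ} (hf : ∀ n, f (-n) = f n) (hf0 : ∀ n, 0 ≤ f n) (L : ℕ) :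
    ∑ h ∈ Finset.Ioo (-L : ℤ) L, f (2 * h) ≤ f 0 + 2 * ∑ h ∈ Finset.Ico 1 (2 * L), f (h : ℕ) := by
  have key : ∀ L : ℕ, ∑ h ∈ Finset.Ioo (-(L + 1 : ℕ) : ℤ) (L + 1 : ℕ), f (2 * h)
      ≤ f 0 + 2 * ∑ h ∈ Finset.Ico 1 (2 * (L + 1)), f (h : ℕ) := by
    intro L
    induction L with
    | zero =>
      have : Finset.Ioo (-(0 + 1 : ℕ) : ℤ) (0 + 1 : ℕ) = {0} := by decide
      rw [this]
      simp [hf0]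
    | succ L ih =>
      have e : Finset.Ioo (-(L + 1 + 1 : ℕ) : ℤ) (L + 1 + 1 : ℕ)
          = insert (L + 1 : ℤ) (insert (-(L + 1) : ℤ)
            (Finset.Ioo (-(L + 1 : ℕ) : ℤ) (L + 1 : ℕ))) := by
        ext x
        simp only [Finset.mem_insert, Finset.mem_Ioo]
        omega
      rw [e, Finset.sum_insert (by simp only [Finset.mem_insert, Finset.mem_Ioo]; omega),
        Finset.sum_insert (by simp only [Finset.mem_Ioo]; omega)]
      have e2 : ∑ h ∈ Finset.Ico 1 (2 * (L + 1 + 1)), f (h : ℕ)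
          = ∑ h ∈ Finset.Ico 1 (2 * (L + 1)), f (h : ℕ) + f (2 * (L + 1)) + f (2 * (L + 1) + 1) := by
        rw [show 2 * (L + 1 + 1) = 2 * (L + 1) + 1 + 1 by ring, Finset.sum_Ico_succ_top (by omega),
          Finset.sum_Ico_succ_top (by omega)]
        push_cast
        ring
      have e3 : f (2 * -(L + 1 : ℤ)) = f (2 * (L + 1)) := by
        rw [mul_neg, hf]
      rw [e2, e3]
      have := hf0 (2 * (L + 1) + 1)
      linarith
  rcases L with _ | L
  · simpa using hf0 0
  · exact key L

/-- The differenced Weyl sum is controlled by one rational approximation. -/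
lemma exists_rat_sum_le (L : ℕ) (hL : 0 < L) (x : AddCircle (1 : ℝ)) :
    ∃ q ∈ Finset.Icc 1 (4 * L), ∃ a ∈ Finset.range q,
      (∑ h ∈ Finset.Ioo (-L : ℤ) L, L / (1 + (L * ‖(2 * h) • x‖) ^ 2)) *
        (q * (1 / (L : ℝ) ^ 2 + ‖x - ((a / q : ℝ) : AddCircle (1 : ℝ))‖)) ≤ 10000 := by
  have hL' : (0 : ℝ) < L := by exact_mod_cast hL
  obtain ⟨ξ, rfl⟩ := QuotientAddGroup.mk_surjective x
  -- The level `4L` ensures `h|β| ≤ 1/(2q)` for all `h ≤ 2L`: the error never exceeds half the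
  -- spacing of the fractions with denominator `q`.
  obtain ⟨r, hr1, hr2⟩ := Real.exists_rat_abs_sub_le_and_den_le ξ (n := 4 * L) (by omega)
  set q := r.den with hqdef
  have hq : 0 < q := r.den_pos
  have hq' : (0 : ℝ) < q := by exact_mod_cast hq
  have hq1 : (1 : ℝ) ≤ q := by exact_mod_cast hq
  have hq4 : (q : ℝ) ≤ 4 * L := by exact_mod_cast hr2
  have : NeZero q := ⟨hq.ne'⟩
  set β : ℝ := ξ - r with hβ
  set z : ZMod q := (r.num : ZMod q) with hz
  have hzu : IsUnit z := by
    have := (ZMod.isUnit_iff_coprime r.num.natAbs q).2 r.reduced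
    rcases Int.natAbs_eq r.num with h | h
    · rw [hz, h]; simpa using this
    · rw [hz, h]; simpa using this
  have hrz : ((r : ℝ) : AddCircle (1 : ℝ)) = ZMod.toAddCircle z := by
    rw [hz, ZMod.toAddCircle_intCast, Rat.cast_def]
  have hξ : (ξ : AddCircle (1 : ℝ)) = ZMod.toAddCircle z + (β : AddCircle (1 : ℝ)) := by
    rw [← hrz, ← AddCircle.coe_add, hβ]; congr 1; ring
  refine ⟨q, Finset.mem_Icc.2 ⟨hq, hr2⟩, z.val, Finset.mem_range.2 (ZMod.val_lt z), ?_⟩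
  have hdist : ‖(ξ : AddCircle (1 : ℝ)) - ((z.val / q : ℝ) : AddCircle (1 : ℝ))‖ ≤ |β| := by
    rw [← ZMod.toAddCircle_apply, hξ, add_sub_cancel_left]
    exact QuotientAddGroup.norm_mk_le_norm.trans (le_of_eq (Real.norm_eq_abs _))
  have hβ1 : (4 * L + 1) * q * |β| ≤ 1 := by
    rw [le_div_iff₀ (by positivity)] at hr1
    push_cast at hr1
    linarith
  set f : ℤ → ℝ := fun h => L / (1 + (L * ‖h • (ξ : AddCircle (1 : ℝ))‖) ^ 2) with hf
  have hsum := sum_Ioo_neg_le (f := f) (fun n => by simp [hf]) (fun n => by positivity) L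
  have hf0 : f 0 = L := by simp [hf]
  have hmul : ∀ h : ℕ, (h : ℤ) • (ξ : AddCircle (1 : ℝ))
      = ZMod.toAddCircle ((h : ZMod q) * z) + ((h * β : ℝ) : AddCircle (1 : ℝ)) := by
    intro h
    rw [hξ, smul_add, ← map_zsmul, ← AddCircle.coe_zsmul]
    simp
  -- If `q ∤ h`, then `hξ` stays at least half as far from `0` as the nonzero residue `hz/q`, and
  -- the `1` in the denominator is dropped. If `q ∣ h`, only the error `hβ` remains.
  have hterm : ∀ h ∈ Finset.Ico 1 (2 * L), f (h : ℕ)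
      ≤ 4 / L * (‖ZMod.toAddCircle ((h : ZMod q) * z)‖ ^ 2)⁻¹
        + if q ∣ h then L / (1 + (L * (h * |β|)) ^ 2) else 0 := by
    intro h hh
    rw [Finset.mem_Ico] at hh
    have hh2 : (h : ℝ) ≤ 2 * L := by exact_mod_cast hh.2.le
    have hhβ : h * |β| * (2 * q) ≤ 1 := by
      have h0 := abs_nonneg β
      calc h * |β| * (2 * q) ≤ 2 * L * |β| * (2 * q) := by gcongr
        _ ≤ (4 * L + 1) * q * |β| := by nlinarith [mul_nonneg hq'.le h0]
        _ ≤ 1 := hβ1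
    simp only [hf]
    rw [hmul]
    by_cases hqh : q ∣ h
    · rw [if_pos hqh]
      have h0 : (h : ZMod q) = 0 := (ZMod.natCast_eq_zero_iff h q).2 hqh
      rw [h0, zero_mul, map_zero, zero_add]
      have h1 : ‖((h * β : ℝ) : AddCircle (1 : ℝ))‖ = h * |β| := by
        rw [(AddCircle.norm_coe_eq_abs_iff 1 one_ne_zero).2, abs_mul, Nat.abs_cast]
        rw [abs_mul, Nat.abs_cast, abs_one]
        have : 0 ≤ h * |β| := by positivity
        nlinarith
      rw [h1]
      simp
    · rw [if_neg hqh, add_zero]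
      set v := ZMod.toAddCircle ((h : ZMod q) * z) with hv
      have h0 : (h : ZMod q) * z ≠ 0 := by
        intro hc
        rw [hzu.mul_left_eq_zero] at hc
        exact hqh ((ZMod.natCast_eq_zero_iff h q).1 hc)
      have hvn : 1 / q ≤ ‖v‖ := by
        rw [hv, ZMod.toAddCircle_apply]
        have h1 := AddCircle.norm_div_natCast (p := (1 : ℝ)) (m := ((h : ZMod q) * z).val) (n := q)
        rw [mul_one, one_mul, Nat.mod_eq_of_lt (ZMod.val_lt _)] at h1
        rw [h1]
        gcongr
        have h2 : 0 < ((h : ZMod q) * z).val := by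
          rw [Nat.pos_iff_ne_zero]
          intro hc
          exact h0 ((ZMod.val_eq_zero _).1 hc)
        have h3 := ZMod.val_lt ((h : ZMod q) * z)
        have : 1 ≤ min ((h : ZMod q) * z).val (q - ((h : ZMod q) * z).val) := by
          rw [le_min_iff]; omega
        exact_mod_cast this
      have hβn : ‖((h * β : ℝ) : AddCircle (1 : ℝ))‖ ≤ ‖v‖ / 2 := by
        calc ‖((h * β : ℝ) : AddCircle (1 : ℝ))‖ ≤ ‖(h * β : ℝ)‖ := QuotientAddGroup.norm_mk_le_norm
          _ = h * |β| := by rw [Real.norm_eq_abs, abs_mul, Nat.abs_cast]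
          _ ≤ 1 / q / 2 := by
            rw [div_div, le_div_iff₀ (by positivity)]
            linarith
          _ ≤ ‖v‖ / 2 := by gcongr
      have hvpos : 0 < ‖v‖ := lt_of_lt_of_le (by positivity) hvn
      have hlow : ‖v‖ / 2 ≤ ‖v + ((h * β : ℝ) : AddCircle (1 : ℝ))‖ := by
        have := norm_sub_le (v + ((h * β : ℝ) : AddCircle (1 : ℝ))) ((h * β : ℝ) : AddCircle (1 : ℝ))
        rw [add_sub_cancel_right] at this
        linarith
      calc L / (1 + (L * ‖v + ((h * β : ℝ) : AddCircle (1 : ℝ))‖) ^ 2)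
          ≤ L / (L * (‖v‖ / 2)) ^ 2 := by
            gcongr
            have : (L * (‖v‖ / 2)) ^ 2 ≤ (L * ‖v + ((h * β : ℝ) : AddCircle (1 : ℝ))‖) ^ 2 := by
              gcongr
            linarith
        _ = 4 / L * (‖v‖ ^ 2)⁻¹ := by field_simp; norm_num
  set B := 2 * L / q + 1 with hB
  have hBq : (q : ℝ) * B ≤ 6 * L := by
    have h1 : q * (2 * L / q) ≤ 2 * L := Nat.mul_div_le _ _
    have h2 : q * B ≤ 6 * L := by rw [hB, mul_add]; omega
    exact_mod_cast h2
  have hBq2 : 2 * L ≤ q * B := by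
    have := Nat.lt_mul_div_succ (2 * L) hq
    rw [hB]; exact this.le
  have hA : ∑ h ∈ Finset.Ico 1 (2 * L), 4 / L * (‖ZMod.toAddCircle ((h : ZMod q) * z)‖ ^ 2)⁻¹
      ≤ 192 * q := by
    calc _ ≤ ∑ h ∈ Finset.range (q * B),
          4 / L * (‖ZMod.toAddCircle ((h : ZMod q) * z)‖ ^ 2)⁻¹ := by
          apply Finset.sum_le_sum_of_subset_of_nonneg
          · intro h hh
            rw [Finset.mem_Ico] at hh
            rw [Finset.mem_range]; omega
          · intro _ _ _; positivity
      _ = 4 / L * (B * ∑ w : ZMod q, (‖ZMod.toAddCircle (w * z)‖ ^ 2)⁻¹) := by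
          rw [← Finset.mul_sum,
            sum_range_mul_zmod q B (fun w => (‖ZMod.toAddCircle (w * z)‖ ^ 2)⁻¹)]
      _ = 4 / L * (B * ∑ w : ZMod q, (‖ZMod.toAddCircle w‖ ^ 2)⁻¹) := by
          congr 2
          exact Fintype.sum_equiv (Units.mulRight hzu.unit) _ _ (fun w => by simp)
      _ ≤ 4 / L * (B * (8 * (q : ℝ) ^ 2)) := by
          gcongr; exact sum_zmod_inv_norm_sq_le q
      _ = 32 / L * q * (q * B) := by ring
      _ ≤ 32 / L * q * (6 * L) := by gcongr
      _ = 192 * q := by field_simp; norm_num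
  set U := 2 * L / q with hU
  set Z := ∑ u ∈ Finset.range U, L / (1 + (L * q * |β| * ((u : ℝ) + 1)) ^ 2) with hZ
  have hZ2 : ∑ h ∈ Finset.Ico 1 (2 * L), (if q ∣ h then L / (1 + (L * (h * |β|)) ^ 2) else 0) ≤ Z := by
    rw [← Finset.sum_filter, hZ]
    have e : ∑ u ∈ Finset.range U, L / (1 + (L * q * |β| * ((u : ℝ) + 1)) ^ 2)
        = ∑ h ∈ (Finset.range U).image (fun u => q * (u + 1)), L / (1 + (L * (h * |β|)) ^ 2) := by
      rw [Finset.sum_image (fun u _ v _ huv => by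
        have := Nat.eq_of_mul_eq_mul_left hq huv
        omega)]
      refine Finset.sum_congr rfl fun u _ => ?_
      push_cast
      ring
    rw [e]
    apply Finset.sum_le_sum_of_subset_of_nonneg
    · intro h hh
      rw [Finset.mem_filter, Finset.mem_Ico] at hh
      obtain ⟨⟨h1, h2⟩, k, rfl⟩ := hh
      rw [Finset.mem_image]
      have hk : 0 < k := by
        rcases Nat.eq_zero_or_pos k with rfl | hk
        · simp at h1
        · exact hk
      refine ⟨k - 1, ?_, by rw [Nat.sub_add_cancel hk]⟩
      rw [Finset.mem_range, hU]
      have : k ≤ 2 * L / q := (Nat.le_div_iff_mul_le hq).2 (by rw [mul_comm]; exact h2.le)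
      omega
    · intro _ _ _; positivity
  -- The multiples of `q` are bounded in two ways, one for each summand of `1/L² + |β|`: by counting
  -- here, and by the Riemann sum bound in `hZb`.
  have hZa : Z * q ≤ 2 * L * L := by
    have h1 : Z ≤ U * L := by
      rw [hZ]
      calc _ ≤ ∑ u ∈ Finset.range U, (L : ℝ) := by
            refine Finset.sum_le_sum fun u _ => ?_
            apply div_le_self hL'.le
            have : 0 ≤ (L * q * |β| * ((u : ℝ) + 1)) ^ 2 := by positivity
            linarith
        _ = U * L := by rw [Finset.sum_const, Finset.card_range, nsmul_eq_mul]
    have h2 : (U : ℝ) * q ≤ 2 * L := by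
      have : U * q ≤ 2 * L := Nat.div_mul_le_self _ _
      exact_mod_cast this
    nlinarith
  have hZb : Z * (q * |β|) ≤ 2 := by
    have h1 := mul_sum_inv_one_add_sq_le (c := L * q * |β|) (by positivity) U
    have h2 : Z = L * ∑ u ∈ Finset.range U, 1 / (1 + (L * q * |β| * ((u : ℝ) + 1)) ^ 2) := by
      rw [hZ, Finset.mul_sum]
      refine Finset.sum_congr rfl fun u _ => by rw [mul_one_div]
    rw [h2]
    calc _ = L * q * |β| * ∑ u ∈ Finset.range U, 1 / (1 + (L * q * |β| * ((u : ℝ) + 1)) ^ 2) := by ring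
      _ ≤ 2 := h1
  have hG : ∑ h ∈ Finset.Ioo (-L : ℤ) L, f (2 * h) ≤ L + 2 * (192 * q + Z) := by
    refine hsum.trans ?_
    rw [hf0]
    have := Finset.sum_le_sum hterm
    rw [Finset.sum_add_distrib] at this
    linarith
  have hZ0 : 0 ≤ Z := Finset.sum_nonneg fun _ _ => by positivity
  calc _ ≤ (L + 2 * (192 * q + Z)) * (q * (1 / (L : ℝ) ^ 2 + |β|)) := by
        gcongr
    _ = q / L + L * q * |β| + 384 * (q / L) ^ 2 + 384 * q * (q * |β|) + 2 * (Z * q / (L ^ 2))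
        + 2 * (Z * (q * |β|)) := by field_simp; ring
    _ ≤ 4 + 1 + 384 * 4 ^ 2 + 384 * 1 + 2 * 2 + 2 * 2 := by
        have hqL : q / L ≤ (4 : ℝ) := by rw [div_le_iff₀ hL']; exact hq4
        have t0 : 0 ≤ q * |β| := by positivity
        have t1 : L * q * |β| ≤ 1 := by nlinarith [mul_nonneg hL'.le t0]
        have t2 : q * (q * |β|) ≤ 1 := by nlinarith [mul_le_mul_of_nonneg_right hq4 t0]
        have t3 : Z * q / L ^ 2 ≤ 2 := by
          rw [div_le_iff₀ (by positivity)]; nlinarith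
        have t4 : (q / L : ℝ) ^ 2 ≤ 4 ^ 2 := by gcongr
        linarith
    _ ≤ 10000 := by norm_num

/-! ### `L^p` bounds for smooth Weyl sums -/

lemma integral_inv_add_norm_rpow_le {ε r : ℝ} (hε : 0 < ε) (hr : 1 < r) :
    ∫ x : AddCircle (1 : ℝ), (1 / (ε + ‖x‖)) ^ r ∂haarAddCircle ≤ 2 * (ε ^ (1 - r) / (r - 1)) := by
  rw [integral_haarAddCircle, inv_one, one_smul,
    ← AddCircle.intervalIntegral_preimage 1 (-(1 / 2)) (fun x : AddCircle (1 : ℝ) => (1 / (ε + ‖x‖)) ^ r)]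
  rw [show (-(1 / 2) + 1 : ℝ) = 1 / 2 by norm_num]
  have e1 : ∫ t in (-(1 / 2) : ℝ)..(1 / 2), (1 / (ε + ‖(t : AddCircle (1 : ℝ))‖)) ^ r
      = ∫ t in (-(1 / 2) : ℝ)..(1 / 2), (1 / (ε + |t|)) ^ r := by
    apply intervalIntegral.integral_congr
    intro t ht
    rw [Set.uIcc_of_le (by norm_num)] at ht
    have : ‖(t : AddCircle (1 : ℝ))‖ = |t| :=
      (AddCircle.norm_coe_eq_abs_iff 1 one_ne_zero).2 (by
        rw [abs_one, abs_le]; exact ht)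
    simp only [this]
  have hcont : Continuous fun t : ℝ => (1 / (ε + |t|)) ^ r := by
    apply Continuous.rpow_const
    · exact continuous_const.div (by fun_prop) (fun t => by positivity)
    · intro t; right; linarith
  have e2 : ∫ t in (-(1 / 2) : ℝ)..0, (1 / (ε + |t|)) ^ r
      = ∫ t in (0 : ℝ)..(1 / 2), (1 / (ε + |t|)) ^ r := by
    have := intervalIntegral.integral_comp_neg (a := (0 : ℝ)) (b := 1 / 2)
      (fun t : ℝ => (1 / (ε + |t|)) ^ r)
    simp only [abs_neg, neg_zero] at this
    exact this.symm
  have e3 : ∫ t in (0 : ℝ)..(1 / 2), (1 / (ε + |t|)) ^ r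
      = ∫ t in (0 : ℝ)..(1 / 2), (t + ε) ^ (-r) := by
    apply intervalIntegral.integral_congr
    intro t ht
    rw [Set.uIcc_of_le (by norm_num)] at ht
    have h0 : 0 < t + ε := by linarith [ht.1]
    simp only
    rw [abs_of_nonneg ht.1, one_div, Real.inv_rpow (by linarith), Real.rpow_neg h0.le, add_comm]
  have e4 : ∫ t in (0 : ℝ)..(1 / 2), (t + ε) ^ (-r) ≤ ε ^ (1 - r) / (r - 1) := by
    rw [intervalIntegral.integral_comp_add_right (fun t : ℝ => t ^ (-r)), zero_add,
      integral_rpow (Or.inr ⟨by linarith, by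
        rw [Set.uIcc_of_le (by linarith)]
        intro h
        linarith [h.1]⟩)]
    rw [show -r + 1 = -(r - 1) by ring, show 1 - r = -(r - 1) by ring, div_neg, ← neg_div]
    apply div_le_div_of_nonneg_right _ (by linarith)
    have : 0 ≤ (1 / 2 + ε) ^ (-(r - 1)) := by positivity
    linarith
  rw [e1, ← intervalIntegral.integral_add_adjacent_intervals
    (hcont.intervalIntegrable _ 0) (hcont.intervalIntegrable _ _), e2, e3]
  linarith

lemma Lp_norm_rpow_eq {P : ENNReal} [hP : Fact (1 ≤ P)] (hP' : P ≠ ⊤)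
    (g : Lp ℂ P (haarAddCircle : Measure (AddCircle (1 : ℝ)))) :
    ‖g‖ ^ P.toReal = ∫ x, ‖g x‖ ^ P.toReal ∂haarAddCircle := by
  have h0 : P ≠ 0 := (zero_lt_one.trans_le hP.out).ne'
  have ht : P.toReal ≠ 0 := ENNReal.toReal_ne_zero.2 ⟨h0, hP'⟩
  rw [Lp.norm_def, (Lp.memLp g).eLpNorm_eq_integral_rpow_norm h0 hP',
    ENNReal.toReal_ofReal (by positivity), ← Real.rpow_mul (by positivity), inv_mul_cancel₀ ht,
    Real.rpow_one]

lemma coeFn_sum_fourierLp {ι : Type*} {P : ENNReal} [Fact (1 ≤ P)] (I : Finset ι) (w : ι → ℂ)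
    (k : ι → ℤ) :
    ((∑ n ∈ I, w n • fourierLp P (k n) : Lp ℂ P (haarAddCircle : Measure (AddCircle (1 : ℝ)))) :
      AddCircle (1 : ℝ) → ℂ) =ᵐ[haarAddCircle] fun x => ∑ n ∈ I, w n * fourier (k n) x := by
  have h : (∑ n ∈ I, w n • fourierLp P (k n) : Lp ℂ P (haarAddCircle : Measure (AddCircle (1 : ℝ))))
      = ContinuousMap.toLp P haarAddCircle ℂ (∑ n ∈ I, w n • fourier (k n)) := by
    rw [map_sum]
    simp only [map_smul, fourierLp]
  rw [h]
  refine (ContinuousMap.coeFn_toLp _ _).trans (Eventually.of_forall fun x => ?_)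
  simp [ContinuousMap.coe_sum]

lemma Lp_norm_rpow_sum_fourierLp {ι : Type*} {P : ENNReal} [Fact (1 ≤ P)] (hP : P ≠ ⊤)
    (I : Finset ι) (w : ι → ℂ) (k : ι → ℤ) :
    ‖(∑ n ∈ I, w n • fourierLp P (k n) :
        Lp ℂ P (haarAddCircle : Measure (AddCircle (1 : ℝ))))‖ ^ P.toReal
      = ∫ x : AddCircle (1 : ℝ), ‖∑ n ∈ I, w n * fourier (k n) x‖ ^ P.toReal ∂haarAddCircle := by
  rw [Lp_norm_rpow_eq hP]
  apply integral_congr_ae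
  filter_upwards [coeFn_sum_fourierLp (P := P) I w k] with x hx
  rw [hx]

lemma Lp_norm_rpow_sum_fourierLp_ofReal {ι : Type*} {p : ℝ} (hp : 0 ≤ p)
    [Fact (1 ≤ ENNReal.ofReal p)] (I : Finset ι) (w : ι → ℂ) (k : ι → ℤ) :
    ‖(∑ n ∈ I, w n • fourierLp (ENNReal.ofReal p) (k n) :
        Lp ℂ (ENNReal.ofReal p) (haarAddCircle : Measure (AddCircle (1 : ℝ))))‖ ^ p
      = ∫ x : AddCircle (1 : ℝ), ‖∑ n ∈ I, w n * fourier (k n) x‖ ^ p ∂haarAddCircle := by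
  have h := Lp_norm_rpow_sum_fourierLp (P := ENNReal.ofReal p) ENNReal.ofReal_ne_top I w k
  rwa [ENNReal.toReal_ofReal hp] at h

/-- The bound for the `p`-th power of the `L^p` norm of a smooth Weyl sum of length `L`. -/
def weylBound (p : ℝ) (L : ℕ) : ℝ :=
  (L : ℝ) ^ (p - 2) * ∑ q ∈ Finset.Icc 1 (4 * L), (q : ℝ) ^ (1 - p / 2)

/-- The rational depends on `x`, so the pointwise bound is majorised by the sum over all `b/q` with
`q ≤ 4L`, reduced or not. By translation invariance each integrates to `q^(-p/2) L^(p-2)` up to a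
constant, as `p/2 > 1`; the `q` numerators give `q^(1-p/2)`. -/
lemma IsBump.Lp_norm_rpow_le {p : ℝ} (hp : 2 < p) [Fact (1 ≤ ENNReal.ofReal p)]
    {w : ℤ → ℝ} {a : ℤ} {L : ℕ} (hw : IsBump w a L) (hL : 0 < L) :
    ‖(∑ n ∈ Finset.Ioo a (a + L), (w n : ℂ) • fourierLp (ENNReal.ofReal p) (n ^ 2) :
        Lp ℂ (ENNReal.ofReal p) (haarAddCircle : Measure (AddCircle (1 : ℝ))))‖ ^ p
      ≤ 180000 ^ (p / 2) * (2 / (p / 2 - 1)) * weylBound p L := by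
  have hL' : (0 : ℝ) < L := by exact_mod_cast hL
  set ε : ℝ := 1 / (L : ℝ) ^ 2 with hε
  have hε0 : 0 < ε := by positivity
  rw [Lp_norm_rpow_sum_fourierLp_ofReal (by linarith)]
  set Φ : AddCircle (1 : ℝ) → ℝ := fun x => (1 / (ε + ‖x‖)) ^ (p / 2) with hΦ
  have hΦc : Continuous Φ := by
    apply Continuous.rpow_const
    · exact continuous_const.div (by fun_prop) (fun t => by positivity)
    · intro t; right; linarith
  have hΦ0 : ∀ x, 0 ≤ Φ x := fun x => by positivity
  have hpt : ∀ x : AddCircle (1 : ℝ),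
      ‖∑ n ∈ Finset.Ioo a (a + L), (w n : ℂ) * fourier (n ^ 2) x‖ ^ p
      ≤ ∑ q ∈ Finset.Icc 1 (4 * L), ∑ b ∈ Finset.range q,
        180000 ^ (p / 2) * ((q : ℝ) ^ (-(p / 2)) * Φ (x - ((b / q : ℝ) : AddCircle (1 : ℝ)))) := by
    intro x
    obtain ⟨q, hq, b, hb, h⟩ := exists_rat_sum_le L hL x
    have hq0 : (0 : ℝ) < q := by
      have := (Finset.mem_Icc.1 hq).1
      exact_mod_cast this
    have h1 := hw.norm_sq_sum_le hL x
    rw [← Finset.mul_sum] at h1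
    set S := ‖∑ n ∈ Finset.Ioo a (a + L), (w n : ℂ) * fourier (n ^ 2) x‖ with hS
    set y := x - ((b / q : ℝ) : AddCircle (1 : ℝ)) with hy
    have hD : 0 < q * (1 / (L : ℝ) ^ 2 + ‖y‖) := by positivity
    rw [← le_div_iff₀ hD] at h
    have h2 : S ^ 2 ≤ 180000 * ((q : ℝ)⁻¹ * (1 / (ε + ‖y‖))) := by
      calc S ^ 2 ≤ _ := h1
        _ ≤ 18 * (10000 / (q * (1 / (L : ℝ) ^ 2 + ‖y‖))) := by gcongr
        _ = 180000 * ((q : ℝ)⁻¹ * (1 / (ε + ‖y‖))) := by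
          rw [← hε]; field_simp; norm_num
    have h3 : S ^ p ≤ 180000 ^ (p / 2) * ((q : ℝ) ^ (-(p / 2)) * Φ y) := by
      have hS0 : 0 ≤ S := norm_nonneg _
      calc S ^ p = (S ^ 2) ^ (p / 2) := by
            rw [← Real.rpow_natCast, ← Real.rpow_mul hS0]
            congr 1; push_cast; ring
        _ ≤ (180000 * ((q : ℝ)⁻¹ * (1 / (ε + ‖y‖)))) ^ (p / 2) := by
            apply Real.rpow_le_rpow (by positivity) h2 (by linarith)
        _ = _ := by
            rw [Real.mul_rpow (by norm_num) (by positivity),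
              Real.mul_rpow (by positivity) (by positivity), Real.inv_rpow hq0.le,
              ← Real.rpow_neg hq0.le]
    refine h3.trans ?_
    refine le_trans ?_ (Finset.single_le_sum (f := fun q : ℕ => ∑ b ∈ Finset.range q,
        180000 ^ (p / 2) * ((q : ℝ) ^ (-(p / 2)) * Φ (x - ((b / q : ℝ) : AddCircle (1 : ℝ)))))
        (fun q _ => Finset.sum_nonneg fun b _ => ?_) hq)
    · exact Finset.single_le_sum (f := fun b : ℕ =>
        180000 ^ (p / 2) * ((q : ℝ) ^ (-(p / 2)) * Φ (x - ((b / q : ℝ) : AddCircle (1 : ℝ)))))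
        (fun b _ => mul_nonneg (by positivity) (mul_nonneg (by positivity) (hΦ0 _))) hb
    · exact mul_nonneg (by positivity) (mul_nonneg (by positivity) (hΦ0 _))
  have hint : ∀ (q b : ℕ), Integrable (fun x : AddCircle (1 : ℝ) => 180000 ^ (p / 2) *
      ((q : ℝ) ^ (-(p / 2)) * Φ (x - ((b / q : ℝ) : AddCircle (1 : ℝ))))) haarAddCircle := by
    intro q b
    apply Continuous.integrable_of_hasCompactSupport
    · exact continuous_const.mul (continuous_const.mul (hΦc.comp (by fun_prop)))
    · exact HasCompactSupport.of_compactSpace _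
  have hint2 : Integrable (fun x : AddCircle (1 : ℝ) =>
      ‖∑ n ∈ Finset.Ioo a (a + L), (w n : ℂ) * fourier (n ^ 2) x‖ ^ p) haarAddCircle := by
    apply Continuous.integrable_of_hasCompactSupport
    · apply Continuous.rpow_const (by fun_prop)
      intro x; right; linarith
    · exact HasCompactSupport.of_compactSpace _
  calc _ ≤ ∫ x, ∑ q ∈ Finset.Icc 1 (4 * L), ∑ b ∈ Finset.range q,
        180000 ^ (p / 2) * ((q : ℝ) ^ (-(p / 2)) * Φ (x - ((b / q : ℝ) : AddCircle (1 : ℝ))))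
          ∂haarAddCircle := by
        apply integral_mono hint2 _ hpt
        exact integrable_finsetSum _ fun q _ => integrable_finsetSum _ fun b _ => hint q b
    _ = ∑ q ∈ Finset.Icc 1 (4 * L), ∑ b ∈ Finset.range q,
        180000 ^ (p / 2) * ((q : ℝ) ^ (-(p / 2)) * ∫ x, Φ x ∂haarAddCircle) := by
        rw [integral_finsetSum _ fun q _ => integrable_finsetSum _ fun b _ => hint q b]
        refine Finset.sum_congr rfl fun q _ => ?_
        rw [integral_finsetSum _ fun b _ => hint q b]
        refine Finset.sum_congr rfl fun b _ => ?_
        rw [integral_const_mul, integral_const_mul, integral_sub_right_eq_self Φ]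
    _ ≤ ∑ q ∈ Finset.Icc 1 (4 * L), ∑ b ∈ Finset.range q,
        180000 ^ (p / 2) * ((q : ℝ) ^ (-(p / 2)) * (2 * (ε ^ (1 - p / 2) / (p / 2 - 1)))) := by
        gcongr
        exact integral_inv_add_norm_rpow_le hε0 (by linarith)
    _ = _ := by
        have hεL : ε ^ (1 - p / 2) = (L : ℝ) ^ (p - 2) := by
          rw [hε, one_div, ← Real.rpow_natCast, ← Real.rpow_neg hL'.le, ← Real.rpow_mul hL'.le]
          congr 1; push_cast; ring
        rw [hεL, weylBound, Finset.mul_sum, Finset.mul_sum]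
        refine Finset.sum_congr rfl fun q hq => ?_
        have hq0 : (0 : ℝ) < q := by
          have := (Finset.mem_Icc.1 hq).1
          exact_mod_cast this
        rw [Finset.sum_const, Finset.card_range, nsmul_eq_mul,
          show 1 - p / 2 = -(p / 2) + 1 by ring, Real.rpow_add_one hq0.ne']
        ring

/-! ### From smooth weights to sharp cutoffs -/

/-- The piecewise linear function which climbs from `0` to `1` on `[0, L]`. -/
def ramp (L : ℕ) (n : ℤ) : ℝ := max 0 (min 1 (n / L))

lemma ramp_of_nonpos {L : ℕ} {n : ℤ} (hn : n ≤ 0) : ramp L n = 0 := by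
  have h : (n : ℝ) / L ≤ 0 := div_nonpos_of_nonpos_of_nonneg (by exact_mod_cast hn) (by positivity)
  exact max_eq_left ((min_le_right _ _).trans h)

lemma ramp_of_ge {L : ℕ} (hL : 0 < L) {n : ℤ} (hn : L ≤ n) : ramp L n = 1 := by
  have h : 1 ≤ (n : ℝ) / L := by
    rw [le_div_iff₀ (by exact_mod_cast hL), one_mul]
    exact_mod_cast hn
  rw [ramp, min_eq_left h, max_eq_right zero_le_one]

lemma ramp_of_mem {L : ℕ} (hL : 0 < L) {n : ℤ} (h0 : 0 ≤ n) (hn : n ≤ L) : ramp L n = n / L := by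
  have h : (n : ℝ) / L ≤ 1 := by
    rw [div_le_one (by exact_mod_cast hL)]
    exact_mod_cast hn
  have h2 : 0 ≤ (n : ℝ) / L := div_nonneg (by exact_mod_cast h0) (by positivity)
  rw [ramp, min_eq_right h, max_eq_right h2]

lemma ramp_nonneg (L : ℕ) (n : ℤ) : 0 ≤ ramp L n := le_max_left _ _

lemma ramp_le_one (L : ℕ) (n : ℤ) : ramp L n ≤ 1 := max_le zero_le_one (min_le_left _ _)

lemma ramp_succ_sub {L : ℕ} (hL : 0 < L) (n : ℤ) :
    ramp L (n + 1) - ramp L n = if 0 ≤ n ∧ n < L then 1 / (L : ℝ) else 0 := by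
  split_ifs with h
  · rw [ramp_of_mem hL (by omega) (by omega), ramp_of_mem hL h.1 h.2.le]
    push_cast; ring
  · rcases lt_or_ge n 0 with h0 | h0
    · rw [ramp_of_nonpos (by omega), ramp_of_nonpos (by omega), sub_zero]
    · rw [ramp_of_ge hL (by omega), ramp_of_ge hL (by omega), sub_self]

lemma abs_ramp_succ_sub_le {L : ℕ} (hL : 0 < L) (n : ℤ) :
    |ramp L (n + 1) - ramp L n| ≤ 1 / L := by
  rw [ramp_succ_sub hL]
  split_ifs
  · rw [abs_of_nonneg (by positivity)]
  · rw [abs_zero]; positivity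

/-- A piecewise linear function has second differences only at its corners, here `0` and `L`, seen
at `n = -1` and `n = L - 1`. -/
lemma ramp_second_le {L : ℕ} (hL : 0 < L) (n : ℤ) :
    |ramp L (n + 2) - 2 * ramp L (n + 1) + ramp L n|
      ≤ (if n = -1 then 1 / (L : ℝ) else 0) + (if n = L - 1 then 1 / (L : ℝ) else 0) := by
  have h1 := ramp_succ_sub hL n
  have h2 := ramp_succ_sub hL (n + 1)
  rw [show n + 1 + 1 = n + 2 by ring] at h2
  have hpos : (0 : ℝ) ≤ 1 / L := by positivity
  have e : ramp L (n + 2) - 2 * ramp L (n + 1) + ramp L n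
      = (ramp L (n + 2) - ramp L (n + 1)) - (ramp L (n + 1) - ramp L n) := by ring
  rw [e, h1, h2]
  split_ifs <;> first | omega | (rw [abs_le]; constructor <;> linarith)

lemma sum_ramp_second_le {L : ℕ} (hL : 0 < L) (a : ℤ) (J : Finset ℤ) :
    ∑ n ∈ J, |ramp L (n + 2 - a) - 2 * ramp L (n + 1 - a) + ramp L (n - a)| ≤ 2 / L := by
  have hpos : (0 : ℝ) ≤ 1 / L := by positivity
  calc _ ≤ ∑ n ∈ J, ((if n = a - 1 then 1 / (L : ℝ) else 0)
        + (if n = a + L - 1 then 1 / (L : ℝ) else 0)) := by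
        refine Finset.sum_le_sum fun n _ => ?_
        have h := ramp_second_le hL (n - a)
        rw [show n - a + 2 = n + 2 - a by ring, show n - a + 1 = n + 1 - a by ring] at h
        refine h.trans (le_of_eq ?_)
        congr 1
        · exact if_congr (by constructor <;> intro <;> omega) rfl rfl
        · exact if_congr (by constructor <;> intro <;> omega) rfl rfl
    _ ≤ 1 / L + 1 / L := by
        rw [Finset.sum_add_distrib, Finset.sum_ite_eq', Finset.sum_ite_eq']
        gcongr <;> split_ifs <;> linarith
    _ = 2 / L := by ring

/-- Serves both shapes of the dyadic decomposition: trapezoids (`L₁ = L₂`) and differences of ramps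
of consecutive scales from the same point (`a = b`). -/
lemma isBump_ramp_sub_ramp {L L₁ L₂ : ℕ} (hL₁ : 0 < L₁) (hL₂ : 0 < L₂) (h₁ : L ≤ 2 * L₁)
    (h₂ : L ≤ 2 * L₂) (hL : 0 < L) {a b : ℤ} (hab : a ≤ b) (hs₁ : a + L₁ ≤ a + L)
    (hs₂ : b + L₂ ≤ a + L) :
    IsBump (fun n => ramp L₁ (n - a) - ramp L₂ (n - b)) a L := by
  have hL' : (0 : ℝ) < L := by exact_mod_cast hL
  have hL₁' : (0 : ℝ) < L₁ := by exact_mod_cast hL₁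
  have hL₂' : (0 : ℝ) < L₂ := by exact_mod_cast hL₂
  have i1 : (1 : ℝ) / L₁ ≤ 2 / L := by
    rw [div_le_div_iff₀ hL₁' hL', one_mul]; exact_mod_cast h₁
  have i2 : (1 : ℝ) / L₂ ≤ 2 / L := by
    rw [div_le_div_iff₀ hL₂' hL', one_mul]; exact_mod_cast h₂
  have i3 : (2 : ℝ) / L + 2 / L ≤ 8 / L := by
    rw [← add_div]; gcongr; norm_num
  constructor
  · intro n hn
    rw [Finset.mem_Ioo]
    by_contra hc
    apply hn
    rcases le_or_gt n a with h | h
    · rw [ramp_of_nonpos (by omega), ramp_of_nonpos (by omega), sub_zero]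
    · have : a + L ≤ n := by
        by_contra h'
        exact hc ⟨h, by omega⟩
      rw [ramp_of_ge hL₁ (by omega), ramp_of_ge hL₂ (by omega), sub_self]
  · intro n
    rw [abs_le]
    have := ramp_nonneg L₁ (n - a)
    have := ramp_nonneg L₂ (n - b)
    have := ramp_le_one L₁ (n - a)
    have := ramp_le_one L₂ (n - b)
    constructor <;> linarith
  · intro n
    have e1 := abs_ramp_succ_sub_le hL₁ (n - a)
    have e2 := abs_ramp_succ_sub_le hL₂ (n - b)
    rw [show n - a + 1 = n + 1 - a by ring] at e1
    rw [show n - b + 1 = n + 1 - b by ring] at e2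
    have e3 := abs_sub (ramp L₁ (n + 1 - a) - ramp L₁ (n - a)) (ramp L₂ (n + 1 - b) - ramp L₂ (n - b))
    rw [show ramp L₁ (n + 1 - a) - ramp L₂ (n + 1 - b) - (ramp L₁ (n - a) - ramp L₂ (n - b))
      = (ramp L₁ (n + 1 - a) - ramp L₁ (n - a)) - (ramp L₂ (n + 1 - b) - ramp L₂ (n - b)) by ring]
    linarith
  · intro J
    have e1 := sum_ramp_second_le hL₁ a J
    have e2 := sum_ramp_second_le hL₂ b J
    have e3 : (2 : ℝ) / L₁ + 2 / L₂ ≤ 8 / L := by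
      have : (2 : ℝ) / L₁ + 2 / L₂ = 2 * (1 / L₁) + 2 * (1 / L₂) := by ring
      rw [this]
      have : (8 : ℝ) / L = 2 * (2 / L) + 2 * (2 / L) := by ring
      linarith
    refine le_trans ?_ ((add_le_add e1 e2).trans e3)
    rw [← Finset.sum_add_distrib]
    refine Finset.sum_le_sum fun n _ => ?_
    refine le_trans (le_of_eq ?_) (abs_sub _ _)
    congr 1
    ring

/-! ### Sharp cutoffs and monotone coefficients in a normed space -/

section Abstract

variable {E : Type*} [NormedAddCommGroup E] [NormedSpace ℂ E]

/-- On integers a ramp of length `1` is a jump, so the sharp cutoff is the trapezoid `w 0`. Doubling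
the ramp length changes the trapezoid by one bump at each endpoint; once the ramps are as long as
the interval, the trapezoid is itself a bump. -/
lemma norm_sum_Ioc_le_sum_dyadic {e : ℤ → E} {B : ℕ → ℝ}
    (hB : ∀ (w : ℤ → ℝ) (a : ℤ) (L : ℕ), 0 < L → IsBump w a L →
      ‖∑ n ∈ Finset.Ioo a (a + L), (w n : ℂ) • e n‖ ≤ B L)
    {a b : ℤ} (hab : a ≤ b) (K : ℕ) (hK : b - a ≤ (2 ^ K : ℕ)) :
    ‖∑ n ∈ Finset.Ioc a b, e n‖ ≤ 2 * ∑ k ∈ Finset.range K, B (2 ^ (k + 1)) + B (2 ^ (K + 1)) := by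
  -- A common index range containing the supports of all weights that occur.
  set J := Finset.Ioc a (b + (2 ^ (K + 1) : ℕ)) with hJ
  set T : (ℤ → ℝ) → E := fun w => ∑ n ∈ J, (w n : ℂ) • e n with hT
  have hTB : ∀ (w : ℤ → ℝ) (c : ℤ) (L : ℕ), 0 < L → IsBump w c L → a ≤ c →
      c + L ≤ b + (2 ^ (K + 1) : ℕ) → ‖T w‖ ≤ B L := by
    intro w c L hL hw hac hcL
    have : T w = ∑ n ∈ Finset.Ioo c (c + L), (w n : ℂ) • e n := by
      symm
      apply Finset.sum_subset
      · intro n hn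
        rw [Finset.mem_Ioo] at hn
        rw [hJ, Finset.mem_Ioc]
        omega
      · intro n _ hn
        have : w n = 0 := by
          by_contra hc
          exact hn (hw.supp n hc)
        simp [this]
    rw [this]
    exact hB w c L hL hw
  set w : ℕ → ℤ → ℝ := fun k n => ramp (2 ^ k) (n - a) - ramp (2 ^ k) (n - b) with hw
  set D : ℕ → ℤ → ℤ → ℝ := fun k c n => ramp (2 ^ k) (n - c) - ramp (2 ^ (k + 1)) (n - c) with hD
  have hpow : ∀ k, 0 < 2 ^ k := fun k => Nat.two_pow_pos k
  have h0 : ∑ n ∈ Finset.Ioc a b, e n = T (w 0) := by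
    change _ = ∑ n ∈ J, (w 0 n : ℂ) • e n
    have hsub : Finset.Ioc a b ⊆ J := by
      intro n hn
      rw [Finset.mem_Ioc] at hn
      rw [hJ, Finset.mem_Ioc]
      omega
    rw [← Finset.sum_subset hsub]
    · refine Finset.sum_congr rfl fun n hn => ?_
      rw [Finset.mem_Ioc] at hn
      simp only [hw]
      rw [ramp_of_ge (hpow 0) (by simp; omega), ramp_of_nonpos (by omega)]
      simp
    · intro n hn hn'
      simp only [hJ, Finset.mem_Ioc] at hn hn'
      simp only [hw]
      rw [ramp_of_ge (hpow 0) (by simp; omega), ramp_of_ge (hpow 0) (by simp; omega)]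
      simp
  have hstep : ∀ k, T (w k) - T (w (k + 1)) = T (D k a) - T (D k b) := by
    intro k
    simp only [hT, ← Finset.sum_sub_distrib, ← sub_smul]
    refine Finset.sum_congr rfl fun n _ => ?_
    congr 1
    simp only [hw, hD]
    push_cast
    ring
  have hdecomp : T (w 0) = ∑ k ∈ Finset.range K, (T (D k a) - T (D k b)) + T (w K) := by
    rw [← Finset.sum_congr rfl fun k _ => hstep k, Finset.sum_range_sub']
    abel
  rw [h0, hdecomp]
  have hDk : ∀ k < K, ∀ c, a ≤ c → c ≤ b → ‖T (D k c)‖ ≤ B (2 ^ (k + 1)) := by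
    intro k hk c hac hcb
    have h2 : 2 ^ (k + 1) ≤ 2 ^ (K + 1) := Nat.pow_le_pow_right (by norm_num) (by omega)
    have h3 : 2 ^ (k + 1) = 2 * 2 ^ k := by ring
    have h4 := hpow k
    apply hTB _ c _ (hpow _) _ hac (by omega)
    apply isBump_ramp_sub_ramp (hpow k) (hpow (k + 1)) <;> omega
  have hwK : ‖T (w K)‖ ≤ B (2 ^ (K + 1)) := by
    have h3 : 2 ^ (K + 1) = 2 * 2 ^ K := by ring
    have h4 := hpow K
    apply hTB _ a _ (hpow _) _ le_rfl (by omega)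
    apply isBump_ramp_sub_ramp (hpow K) (hpow K) <;> omega
  calc _ ≤ ∑ k ∈ Finset.range K, (B (2 ^ (k + 1)) + B (2 ^ (k + 1))) + B (2 ^ (K + 1)) := by
        refine (norm_add_le _ _).trans (add_le_add ((norm_sum_le _ _).trans ?_) hwK)
        refine Finset.sum_le_sum fun k hk => (norm_sub_le _ _).trans ?_
        rw [Finset.mem_range] at hk
        exact add_le_add (hDk k hk a le_rfl hab) (hDk k hk b hab le_rfl)
    _ = _ := by
        rw [Finset.sum_add_distrib]; ring

lemma norm_sum_antitone_smul_le {e : ℕ → E} {v : ℕ → ℝ} (hv : Antitone v) (hv0 : ∀ n, 0 ≤ v n)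
    {X : ℝ} {m : ℕ} (hX : ∀ k ≤ m, ‖∑ i ∈ Finset.range k, e i‖ ≤ X) :
    ‖∑ i ∈ Finset.range m, (v i : ℂ) • e i‖ ≤ v 0 * X := by
  have hX0 : 0 ≤ X := by simpa using hX 0 (Nat.zero_le _)
  rcases m with _ | m
  · simpa using mul_nonneg (hv0 0) hX0
  -- Abel summation by induction: each step adds `(v k - v (k + 1))` times a partial sum, and these
  -- weights telescope.
  have key : ∀ k ≤ m, ‖∑ i ∈ Finset.range (k + 1), (v i : ℂ) • e i
      - (v k : ℂ) • ∑ i ∈ Finset.range (k + 1), e i‖ ≤ (v 0 - v k) * X := by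
    intro k
    induction k with
    | zero => simp
    | succ k ih =>
      intro hk
      have e1 : ∑ i ∈ Finset.range (k + 1 + 1), (v i : ℂ) • e i
          - (v (k + 1) : ℂ) • ∑ i ∈ Finset.range (k + 1 + 1), e i
          = (∑ i ∈ Finset.range (k + 1), (v i : ℂ) • e i
            - (v k : ℂ) • ∑ i ∈ Finset.range (k + 1), e i)
            + ((v k - v (k + 1) : ℝ) : ℂ) • ∑ i ∈ Finset.range (k + 1), e i := by
        rw [Finset.sum_range_succ _ (k + 1), Finset.sum_range_succ e (k + 1), smul_add]
        push_cast
        rw [sub_smul]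
        abel
      rw [e1]
      refine (norm_add_le _ _).trans ?_
      have h1 := ih (by omega)
      have h2 : 0 ≤ v k - v (k + 1) := sub_nonneg.2 (hv (Nat.le_succ k))
      rw [norm_smul, Complex.norm_real, Real.norm_eq_abs, abs_of_nonneg h2]
      have h3 := mul_le_mul_of_nonneg_left (hX (k + 1) (by omega)) h2
      linarith
  have h1 := key m le_rfl
  have h2 := norm_sub_norm_le (∑ i ∈ Finset.range (m + 1), (v i : ℂ) • e i)
    ((v m : ℂ) • ∑ i ∈ Finset.range (m + 1), e i)
  have h3 : ‖(v m : ℂ) • ∑ i ∈ Finset.range (m + 1), e i‖ ≤ v m * X := by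
    rw [norm_smul, Complex.norm_real, Real.norm_eq_abs, abs_of_nonneg (hv0 m)]
    exact mul_le_mul_of_nonneg_left (hX _ le_rfl) (hv0 m)
  linarith

/-- The growth profile `x ^ α * (1 + log x) ^ κ`. -/
def growth (α κ x : ℝ) : ℝ := x ^ α * (1 + Real.log x) ^ κ

lemma growth_nonneg (α κ : ℝ) {x : ℝ} (hx : 1 ≤ x) : 0 ≤ growth α κ x := by
  have := Real.log_nonneg hx
  unfold growth
  positivity

lemma growth_mono {α κ : ℝ} (hα : 0 ≤ α) (hκ : 0 ≤ κ) {x y : ℝ} (hx : 1 ≤ x) (hxy : x ≤ y) :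
    growth α κ x ≤ growth α κ y := by
  have h1 := Real.log_nonneg hx
  have h2 : Real.log x ≤ Real.log y := Real.log_le_log (by linarith) hxy
  have hy : 0 ≤ y := by linarith
  unfold growth
  gcongr

lemma growth_two_pow_mul_le {α κ : ℝ} (hκ : 0 ≤ κ) (hκ1 : κ ≤ 1) {x : ℝ} (hx : 1 ≤ x) (k : ℕ) :
    growth α κ (2 ^ k * x) ≤ ((2 : ℝ) ^ α) ^ k * (1 + k) * growth α κ x := by
  have h1 := Real.log_nonneg hx
  have hx0 : 0 < x := by linarith
  unfold growth
  have e1 : ((2 : ℝ) ^ k * x) ^ α = ((2 : ℝ) ^ α) ^ k * x ^ α := by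
    rw [Real.mul_rpow (by positivity) hx0.le, ← Real.rpow_natCast, ← Real.rpow_natCast,
      ← Real.rpow_mul (by norm_num), ← Real.rpow_mul (by norm_num), mul_comm (k : ℝ)]
  have h2 : 1 + Real.log (2 ^ k * x) ≤ (1 + k) * (1 + Real.log x) := by
    rw [Real.log_mul (by positivity) hx0.ne', Real.log_pow]
    have h3 : Real.log 2 ≤ 1 := by
      have := Real.log_two_lt_d9; linarith
    have h4 : (k : ℝ) * Real.log 2 ≤ k := by
      have : (0 : ℝ) ≤ k := by positivity
      nlinarith
    have : 0 ≤ (k : ℝ) * Real.log x := by positivity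
    linarith
  have h0 : 0 ≤ 1 + Real.log (2 ^ k * x) := by
    have : 0 ≤ Real.log (2 ^ k * x) := by
      apply Real.log_nonneg
      have : (1 : ℝ) ≤ 2 ^ k := one_le_pow₀ (by norm_num)
      nlinarith
    linarith
  have h5 : (1 + Real.log (2 ^ k * x)) ^ κ ≤ (1 + k) * (1 + Real.log x) ^ κ := by
    calc _ ≤ ((1 + k) * (1 + Real.log x)) ^ κ := Real.rpow_le_rpow h0 h2 hκ
      _ = (1 + k : ℝ) ^ κ * (1 + Real.log x) ^ κ := Real.mul_rpow (by positivity) (by positivity)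
      _ ≤ (1 + k : ℝ) ^ (1 : ℝ) * (1 + Real.log x) ^ κ := by
        gcongr
        linarith [(Nat.cast_nonneg k : (0 : ℝ) ≤ k)]
      _ = _ := by rw [Real.rpow_one]
  rw [e1]
  calc _ ≤ ((2 : ℝ) ^ α) ^ k * x ^ α * ((1 + k) * (1 + Real.log x) ^ κ) := by gcongr
    _ = _ := by ring

lemma sum_growth_two_pow_le {α κ : ℝ} (hα : 0 < α) (hκ : 0 ≤ κ) (K : ℕ) :
    ∑ k ∈ Finset.range K, growth α κ ((2 ^ (k + 1) : ℕ) : ℝ)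
      ≤ 2 ^ α / (2 ^ α - 1) * growth α κ ((2 ^ K : ℕ) : ℝ) := by
  have hr : (1 : ℝ) < 2 ^ α := Real.one_lt_rpow (by norm_num) hα
  have hpow : ∀ k : ℕ, (((2 ^ k : ℕ) : ℝ)) ^ α = ((2 : ℝ) ^ α) ^ k := by
    intro k
    push_cast
    rw [← Real.rpow_natCast, ← Real.rpow_natCast, ← Real.rpow_mul (by norm_num),
      ← Real.rpow_mul (by norm_num), mul_comm (k : ℝ)]
  have hlog : ∀ k : ℕ, 0 ≤ Real.log ((2 ^ k : ℕ) : ℝ) := fun k =>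
    Real.log_natCast_nonneg _
  calc _ ≤ ∑ k ∈ Finset.range K, ((2 : ℝ) ^ α) ^ (k + 1) * (1 + Real.log ((2 ^ K : ℕ) : ℝ)) ^ κ := by
        refine Finset.sum_le_sum fun k hk => ?_
        rw [growth, hpow]
        have := hlog (k + 1)
        gcongr
        · norm_num
        · exact Finset.mem_range.1 hk
    _ = 2 ^ α * (∑ k ∈ Finset.range K, ((2 : ℝ) ^ α) ^ k) * (1 + Real.log ((2 ^ K : ℕ) : ℝ)) ^ κ := by
        rw [Finset.mul_sum, Finset.sum_mul]
        refine Finset.sum_congr rfl fun k _ => by rw [pow_succ]; ring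
    _ ≤ 2 ^ α * (((2 : ℝ) ^ α) ^ K / (2 ^ α - 1)) * (1 + Real.log ((2 ^ K : ℕ) : ℝ)) ^ κ := by
        have := hlog K
        rw [geom_sum_eq hr.ne']
        gcongr
        linarith
    _ = _ := by
        rw [growth, hpow]; ring

/-- Since `α > 0`, the dyadic sum is dominated by its top scale, so a sharp cutoff costs only a
constant. -/
lemma exists_norm_sum_Ioc_le {e : ℤ → E} {α κ C₀ : ℝ} (hα : 0 < α) (hκ : 0 ≤ κ) (hκ1 : κ ≤ 1)
    (hC₀ : 0 ≤ C₀)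
    (hB : ∀ (w : ℤ → ℝ) (a : ℤ) (L : ℕ), 0 < L → IsBump w a L →
      ‖∑ n ∈ Finset.Ioo a (a + L), (w n : ℂ) • e n‖ ≤ C₀ * growth α κ L) :
    ∃ C, 0 ≤ C ∧ ∀ (a b : ℤ) (M : ℕ), 1 ≤ M → a ≤ b → b - a ≤ M →
      ‖∑ n ∈ Finset.Ioc a b, e n‖ ≤ C * growth α κ M := by
  have hr : (1 : ℝ) < 2 ^ α := Real.one_lt_rpow (by norm_num) hα
  have hr' : 0 < (2 : ℝ) ^ α - 1 := by linarith
  set A : ℝ := 2 ^ α / (2 ^ α - 1) with hA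
  have hA0 : 0 ≤ A := by positivity
  set G : ℝ := 2 ^ α * 2 with hG
  refine ⟨C₀ * (2 * A * G + G * G), by positivity, ?_⟩
  intro a b M hM hab hbM
  set K := Nat.clog 2 M with hK
  have hK1 : M ≤ 2 ^ K := Nat.le_pow_clog (by norm_num) M
  have hK2 : 2 ^ K ≤ 2 * M := by
    rcases Nat.lt_or_ge 1 M with h | h
    · have h1 := Nat.pow_pred_clog_lt_self (b := 2) (by norm_num) h
      have h2 : 0 < K := Nat.clog_pos (by norm_num) h
      have h3 : 2 ^ K = 2 * 2 ^ (K.pred) := by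
        rw [← pow_succ', Nat.pred_eq_sub_one, Nat.sub_add_cancel h2]
      rw [h3, hK]
      omega
    · have : M = 1 := by omega
      simp [hK, this]
  have hMr : (1 : ℝ) ≤ M := by exact_mod_cast hM
  have g1 : growth α κ ((2 ^ K : ℕ) : ℝ) ≤ G * growth α κ M := by
    have h1 : growth α κ ((2 ^ K : ℕ) : ℝ) ≤ growth α κ (2 ^ 1 * M) := by
      apply growth_mono hα.le hκ
      · exact_mod_cast Nat.one_le_two_pow
      · rw [pow_one]; exact_mod_cast hK2
    have h2 := growth_two_pow_mul_le (α := α) hκ hκ1 hMr 1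
    calc _ ≤ _ := h1.trans h2
      _ = G * growth α κ M := by rw [hG, pow_one]; push_cast; ring
  have g2 : growth α κ ((2 ^ (K + 1) : ℕ) : ℝ) ≤ G * growth α κ ((2 ^ K : ℕ) : ℝ) := by
    have h2 := growth_two_pow_mul_le (α := α) (x := ((2 ^ K : ℕ) : ℝ)) hκ hκ1
      (by exact_mod_cast Nat.one_le_two_pow) 1
    rw [show ((2 ^ (K + 1) : ℕ) : ℝ) = 2 ^ 1 * ((2 ^ K : ℕ) : ℝ) by push_cast; ring]
    refine h2.trans (le_of_eq ?_)
    rw [hG, pow_one]; push_cast; ring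
  have hG0 : 0 ≤ G := by positivity
  have main := norm_sum_Ioc_le_sum_dyadic (B := fun L : ℕ => C₀ * growth α κ L) hB hab K
    (hbM.trans (by exact_mod_cast hK1))
  rw [← Finset.mul_sum] at main
  have hs := sum_growth_two_pow_le (κ := κ) hα hκ K
  calc _ ≤ _ := main
    _ ≤ 2 * (C₀ * (A * (G * growth α κ M))) + C₀ * (G * (G * growth α κ M)) := by
        gcongr
        · exact hs.trans (by gcongr)
        · exact g2.trans (by gcongr)
    _ = _ := by ring

/-- The coefficient `n ^ (-2s)`. -/
def coef (s : ℝ) (n : ℕ) : ℝ := 1 / (n : ℝ) ^ (2 * s)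

lemma coef_nonneg (s : ℝ) (n : ℕ) : 0 ≤ coef s n := by unfold coef; positivity

lemma coef_anti {s : ℝ} (hs : 0 ≤ s) {m n : ℕ} (hm : 1 ≤ m) (hmn : m ≤ n) :
    coef s n ≤ coef s m := by
  unfold coef
  have : (0 : ℝ) < m := by exact_mod_cast hm
  gcongr

lemma norm_sum_Ico_coef_le {e : ℤ → E} {s X : ℝ} (hs : 0 ≤ s) {A K : ℕ} (hA : 1 ≤ A)
    (hX : ∀ b : ℤ, A - 1 ≤ b → b + 1 ≤ K → ‖∑ n ∈ Finset.Ioc (A - 1 : ℤ) b, e n‖ ≤ X) (hX0 : 0 ≤ X) :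
    ‖∑ n ∈ Finset.Ico A K, (coef s n : ℂ) • e n‖ ≤ coef s A * X := by
  have h := norm_sum_antitone_smul_le (e := fun i => e ((A + i : ℕ) : ℤ))
    (v := fun i => coef s (A + i)) (X := X) (m := K - A)
    (fun i j hij => coef_anti hs (by omega) (by omega)) (fun _ => coef_nonneg _ _) (by
      intro k hk
      rcases Nat.eq_zero_or_pos k with rfl | hk0
      · simpa using hX0
      have := hX (A - 1 + k) (by omega) (by omega)
      convert this using 2
      rw [show ∑ i ∈ Finset.range k, e ((A + i : ℕ) : ℤ)
        = ∑ n ∈ (Finset.range k).image (fun i : ℕ => ((A + i : ℕ) : ℤ)), e n from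
        (Finset.sum_image (fun i _ j _ hij => by simpa using hij)).symm]
      congr 1
      ext n
      simp only [Finset.mem_image, Finset.mem_range, Finset.mem_Ioc]
      constructor
      · rintro ⟨i, hi, rfl⟩
        omega
      · rintro ⟨h1, h2⟩
        exact ⟨(n - A).toNat, by omega, by omega⟩)
  rw [Finset.sum_Ico_eq_sum_range]
  simpa using h

/-- On `[2^j M, 2^(j+1) M)` Abel summation gives the value of `coef * growth` at the left end, at
most `(1 + j) 2^(j(α-2s))` times its value at `M`. Uniformity in `K` is what later gives Cauchy
sequences. -/
lemma exists_norm_sum_coef_le {e : ℤ → E} {α κ C₀ s : ℝ} (hα : 0 < α) (hκ : 0 ≤ κ) (hκ1 : κ ≤ 1)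
    (hC₀ : 0 ≤ C₀) (hs : α < 2 * s)
    (hB : ∀ (w : ℤ → ℝ) (a : ℤ) (L : ℕ), 0 < L → IsBump w a L →
      ‖∑ n ∈ Finset.Ioo a (a + L), (w n : ℂ) • e n‖ ≤ C₀ * growth α κ L) :
    ∃ C, 0 ≤ C ∧ ∀ M K : ℕ, 1 ≤ M →
      ‖∑ n ∈ Finset.Ico M K, (coef s n : ℂ) • e n‖ ≤ C * (coef s M * growth α κ M) := by
  obtain ⟨C₁, hC₁, h₁⟩ := exists_norm_sum_Ioc_le hα hκ hκ1 hC₀ hB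
  have hs0 : 0 ≤ s := by linarith
  set ρ : ℝ := 2 ^ (α - 2 * s) with hρ
  have hρ1 : ρ < 1 := Real.rpow_lt_one_of_one_lt_of_neg (by norm_num) (by linarith)
  have hρ0 : 0 < ρ := by positivity
  have hsum : Summable fun j : ℕ => ((1 : ℝ) + j) * ρ ^ j := by
    have a1 := summable_pow_mul_geometric_of_norm_lt_one 1 (r := ρ)
      (by rwa [Real.norm_eq_abs, abs_of_pos hρ0])
    have a2 := summable_geometric_of_lt_one hρ0.le hρ1
    refine (a2.add a1).congr fun j => ?_
    rw [pow_one]; ring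
  have hpos : ∀ j : ℕ, 0 ≤ ((1 : ℝ) + j) * ρ ^ j := fun j => by positivity
  refine ⟨C₁ * ∑' j : ℕ, ((1 : ℝ) + j) * ρ ^ j, mul_nonneg hC₁ (tsum_nonneg hpos), ?_⟩
  intro M K hM
  have hMr : (1 : ℝ) ≤ M := by exact_mod_cast hM
  have block : ∀ A K : ℕ, 1 ≤ A → K ≤ 2 * A →
      ‖∑ n ∈ Finset.Ico A K, (coef s n : ℂ) • e n‖ ≤ C₁ * (coef s A * growth α κ A) := by
    intro A K hA hK
    have hA1 : (1 : ℝ) ≤ A := by exact_mod_cast hA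
    have := norm_sum_Ico_coef_le (e := e) (K := K) hs0 hA
      (fun b hb hb2 => h₁ (A - 1) b A hA hb (by omega)) (mul_nonneg hC₁ (growth_nonneg _ _ hA1))
    linarith
  have hdy : ∀ j : ℕ, coef s (2 ^ j * M) * growth α κ ((2 ^ j * M : ℕ) : ℝ)
      ≤ ((1 : ℝ) + j) * ρ ^ j * (coef s M * growth α κ M) := by
    intro j
    have e1 : coef s (2 ^ j * M) = ((2 : ℝ) ^ (-(2 * s))) ^ j * coef s M := by
      unfold coef
      push_cast
      rw [Real.mul_rpow (by positivity) (by positivity), ← Real.rpow_natCast, ← Real.rpow_natCast,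
        ← Real.rpow_mul (by norm_num), ← Real.rpow_mul (by norm_num), one_div, mul_inv,
        ← Real.rpow_neg (by norm_num), one_div]
      ring_nf
    have e2 := growth_two_pow_mul_le (α := α) hκ hκ1 hMr j
    have e3 : ρ ^ j = ((2 : ℝ) ^ (-(2 * s))) ^ j * ((2 : ℝ) ^ α) ^ j := by
      rw [← mul_pow, ← Real.rpow_add (by norm_num), hρ]
      ring_nf
    rw [e1, e3]
    push_cast
    have := coef_nonneg s M
    calc _ ≤ ((2 : ℝ) ^ (-(2 * s))) ^ j * coef s M
          * (((2 : ℝ) ^ α) ^ j * (1 + j) * growth α κ M) := by gcongr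
      _ = _ := by ring
  have hY0 : 0 ≤ coef s M * growth α κ M := mul_nonneg (coef_nonneg _ _) (growth_nonneg _ _ hMr)
  have key : ∀ J : ℕ, ∀ K ≤ 2 ^ J * M, ‖∑ n ∈ Finset.Ico M K, (coef s n : ℂ) • e n‖
      ≤ ∑ j ∈ Finset.range J, C₁ * (((1 : ℝ) + j) * ρ ^ j * (coef s M * growth α κ M)) := by
    intro J
    induction J with
    | zero =>
      intro K hK
      rw [Finset.Ico_eq_empty (by omega)]
      simp
    | succ J ih =>
      intro K hK
      rw [Finset.sum_range_succ]
      have hnn : 0 ≤ C₁ * (((1 : ℝ) + J) * ρ ^ J * (coef s M * growth α κ M)) :=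
        mul_nonneg hC₁ (mul_nonneg (hpos J) hY0)
      rcases le_total K (2 ^ J * M) with h | h
      · linarith [ih K h]
      · have hMJ : M ≤ 2 ^ J * M := Nat.le_mul_of_pos_left _ (Nat.two_pow_pos J)
        rw [← Finset.sum_Ico_consecutive _ hMJ h]
        refine (norm_add_le _ _).trans (add_le_add (ih _ le_rfl) ?_)
        have := block (2 ^ J * M) K (by omega) (by rw [pow_succ] at hK; linarith)
        refine this.trans ?_
        exact mul_le_mul_of_nonneg_left (hdy J) hC₁
  refine (key K K (by
    calc K ≤ 2 ^ K := Nat.lt_two_pow_self.le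
      _ ≤ 2 ^ K * M := Nat.le_mul_of_pos_right _ (by omega))).trans ?_
  rw [← Finset.mul_sum, ← Finset.sum_mul, mul_assoc]
  gcongr
  exact hsum.sum_le_tsum _ (fun j _ => hpos j)

end Abstract

/-! ### `L^p` bounds for truncated series -/

/-- The exponent of the length in the `L^p` norm of a Weyl sum. -/
def lengthExp (p : ℝ) : ℝ := if p ≤ 4 then 1 / 2 else 1 - 2 / p

/-- The exponent of the logarithm in the `L^p` norm of a Weyl sum. -/
def logExp (p : ℝ) : ℝ := if p = 4 then 1 / 4 else 0

lemma lengthExp_pos (p : ℝ) : 0 < lengthExp p := by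
  unfold lengthExp
  split_ifs with h
  · norm_num
  · push Not at h
    have : 2 / p < 1 := by rw [div_lt_one (by linarith)]; linarith
    linarith

lemma logExp_nonneg (p : ℝ) : 0 ≤ logExp p := by
  unfold logExp; split_ifs <;> norm_num

lemma logExp_le_one (p : ℝ) : logExp p ≤ 1 := by
  unfold logExp; split_ifs <;> norm_num

lemma lengthExp_lt_of_sStar_lt {p s : ℝ} (hs : sStar p < s) : lengthExp p < 2 * s := by
  unfold sStar at hs
  unfold lengthExp
  split_ifs at * with h
  · linarith
  · have : 2 / p = 2 * (1 / p) := by ring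
    linarith

/-- Comparison with `∫ t^(-σ)`; the inductive step is Bernoulli's inequality for the exponent `1 - σ
∈ (0, 1]`. -/
lemma sum_Icc_rpow_neg_le {σ : ℝ} (h0 : 0 ≤ σ) (h1 : σ < 1) (n : ℕ) :
    ∑ q ∈ Finset.Icc 1 n, (q : ℝ) ^ (-σ) ≤ (n : ℝ) ^ (1 - σ) / (1 - σ) := by
  have hσ : 0 < 1 - σ := by linarith
  induction n with
  | zero => simp [Real.zero_rpow hσ.ne']
  | succ n ih =>
    rw [Finset.sum_Icc_succ_top (by omega)]
    have hn : (0 : ℝ) < (n + 1 : ℕ) := by positivity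
    set m : ℝ := ((n + 1 : ℕ) : ℝ) with hm
    have hnm : (n : ℝ) = m * (1 + -(1 / m)) := by
      rw [hm]; push_cast; field_simp; ring
    have hm1 : 1 / m ≤ 1 := by
      rw [div_le_one hn, hm]; push_cast; linarith [(Nat.cast_nonneg n : (0 : ℝ) ≤ n)]
    have hb := rpow_one_add_le_one_add_mul_self (s := -(1 / m)) (by linarith) hσ.le (by linarith)
    have h2 : (n : ℝ) ^ (1 - σ) ≤ m ^ (1 - σ) - (1 - σ) * m ^ (-σ) := by
      rw [hnm, Real.mul_rpow hn.le (by linarith)]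
      calc _ ≤ m ^ (1 - σ) * (1 + (1 - σ) * -(1 / m)) := by gcongr
        _ = m ^ (1 - σ) - (1 - σ) * (m ^ (1 - σ) / m) := by ring
        _ = m ^ (1 - σ) - (1 - σ) * m ^ (-σ) := by
          rw [← Real.rpow_sub_one hn.ne']
          ring_nf
    have h3 : (n : ℝ) ^ (1 - σ) / (1 - σ) ≤ m ^ (1 - σ) / (1 - σ) - m ^ (-σ) := by
      rw [div_le_iff₀ hσ, sub_mul, div_mul_cancel₀ _ hσ.ne']
      linarith
    linarith

/-- The origin of the three regimes: `∑_{q ≤ 4L} q^(1-p/2)` grows like a power, grows like a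
logarithm, or converges. -/
lemma exists_weylBound_le {p : ℝ} (hp : 2 < p) :
    ∃ C, 0 ≤ C ∧ ∀ L : ℕ, 0 < L →
      weylBound p L ≤ C * growth (lengthExp p) (logExp p) L ^ p := by
  rcases lt_trichotomy p 4 with h | h | h
  · refine ⟨4 ^ (2 - p / 2) / (2 - p / 2), div_nonneg (by positivity) (by linarith), ?_⟩
    intro L hL
    have hL' : (0 : ℝ) < L := by exact_mod_cast hL
    have h1 := sum_Icc_rpow_neg_le (σ := p / 2 - 1) (by linarith) (by linarith) (4 * L)
    rw [show -(p / 2 - 1) = 1 - p / 2 by ring, show 1 - (p / 2 - 1) = 2 - p / 2 by ring] at h1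
    push_cast at h1
    rw [Real.mul_rpow (by norm_num) hL'.le] at h1
    unfold weylBound growth lengthExp logExp
    rw [if_pos h.le, if_neg h.ne, Real.rpow_zero, mul_one, ← Real.rpow_mul hL'.le]
    calc _ ≤ (L : ℝ) ^ (p - 2) * (4 ^ (2 - p / 2) * (L : ℝ) ^ (2 - p / 2) / (2 - p / 2)) := by gcongr
      _ = 4 ^ (2 - p / 2) / (2 - p / 2) * ((L : ℝ) ^ (p - 2) * (L : ℝ) ^ (2 - p / 2)) := by ring
      _ = _ := by
        rw [← Real.rpow_add hL']
        congr 2; ring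
  · refine ⟨4, by norm_num, ?_⟩
    intro L hL
    have hL' : (0 : ℝ) < L := by exact_mod_cast hL
    have hlog : 0 ≤ Real.log L := Real.log_natCast_nonneg L
    unfold weylBound growth lengthExp logExp
    rw [if_pos h.le, if_pos h, h, Real.mul_rpow (by positivity) (by positivity),
      ← Real.rpow_mul hL'.le, ← Real.rpow_mul (by positivity)]
    norm_num
    have h1 := harmonic_le_one_add_log (4 * L)
    rw [harmonic_eq_sum_Icc] at h1
    push_cast at h1
    rw [Real.log_mul (by norm_num) hL'.ne'] at h1
    have h2 : Real.log 4 ≤ 2 := by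
      rw [show (4 : ℝ) = 2 ^ 2 by norm_num, Real.log_pow]
      have := Real.log_two_lt_d9
      push_cast; linarith
    have h3 : ∑ q ∈ Finset.Icc 1 (4 * L), (q : ℝ) ^ (-1 : ℝ) ≤ 4 * (1 + Real.log L) := by
      simp_rw [Real.rpow_neg_one]
      linarith
    calc _ ≤ (L : ℝ) ^ (2 : ℕ) * (4 * (1 + Real.log L)) := by gcongr
      _ = _ := by ring
  · have hsum : Summable fun q : ℕ => (q : ℝ) ^ (1 - p / 2) :=
      Real.summable_nat_rpow.2 (by linarith)
    refine ⟨∑' q : ℕ, (q : ℝ) ^ (1 - p / 2), tsum_nonneg fun q => by positivity, ?_⟩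
    intro L hL
    have hL' : (0 : ℝ) < L := by exact_mod_cast hL
    unfold weylBound growth lengthExp logExp
    rw [if_neg (by linarith), if_neg h.ne', Real.rpow_zero, mul_one, ← Real.rpow_mul hL'.le,
      show (1 - 2 / p) * p = p - 2 by field_simp, mul_comm]
    gcongr
    exact hsum.sum_le_tsum _ fun q _ => by positivity

/-- The truncated series `∑_{M ≤ n < K} n ^ (-2s) e(n² x)` as an element of `L^P`. -/
def truncLp (P : ENNReal) [Fact (1 ≤ P)] (s : ℝ) (M K : ℕ) :
    Lp ℂ P (haarAddCircle : Measure (AddCircle (1 : ℝ))) :=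
  ∑ n ∈ Finset.Ico M K, (coef s n : ℂ) • fourierLp P ((n : ℤ) ^ 2)

lemma exists_norm_truncLp_le {p s : ℝ} (hp : 2 < p) (hs : sStar p < s)
    [Fact (1 ≤ ENNReal.ofReal p)] :
    ∃ C, 0 ≤ C ∧ ∀ M K : ℕ, 1 ≤ M → ‖truncLp (ENNReal.ofReal p) s M K‖
      ≤ C * (coef s M * growth (lengthExp p) (logExp p) M) := by
  obtain ⟨C, hC, h⟩ := exists_weylBound_le hp
  have hp0 : 0 < p := by linarith
  have hA : 0 ≤ (180000 : ℝ) ^ (p / 2) * (2 / (p / 2 - 1)) :=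
    mul_nonneg (by positivity) (div_nonneg (by norm_num) (by linarith))
  refine exists_norm_sum_coef_le (e := fun n : ℤ => (fourierLp (ENNReal.ofReal p) (n ^ 2) :
    Lp ℂ (ENNReal.ofReal p) (haarAddCircle : Measure (AddCircle (1 : ℝ)))))
    (C₀ := (180000 ^ (p / 2) * (2 / (p / 2 - 1)) * C) ^ (1 / p))
    (lengthExp_pos p) (logExp_nonneg p) (logExp_le_one p) (by positivity)
    (lengthExp_lt_of_sStar_lt hs) ?_
  intro w a L hL hw
  have hL1 : (1 : ℝ) ≤ L := by exact_mod_cast hL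
  have h1 := hw.Lp_norm_rpow_le hp hL
  have hg := growth_nonneg (lengthExp p) (logExp p) hL1
  have h2 := h1.trans (mul_le_mul_of_nonneg_left (h L hL) hA)
  rw [← mul_assoc] at h2
  have h3 := Real.rpow_le_rpow (by positivity) h2 (by positivity : 0 ≤ 1 / p)
  rw [← Real.rpow_mul (norm_nonneg _), mul_one_div_cancel hp0.ne', Real.rpow_one,
    Real.mul_rpow (by positivity) (by positivity), ← Real.rpow_mul hg,
    mul_one_div_cancel hp0.ne', Real.rpow_one] at h3
  exact h3

lemma tendsto_coef_mul_growth {α κ s : ℝ} (hκ : κ ≤ 1) (hs : α < 2 * s) :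
    Tendsto (fun M : ℕ => coef s M * growth α κ M) atTop (nhds 0) := by
  set η := 2 * s - α with hη
  have hη0 : 0 < η := by linarith
  have h1 : Tendsto (fun x : ℝ => x ^ (-η) * (1 + Real.log x)) atTop (nhds 0) := by
    have a1 := tendsto_rpow_neg_atTop hη0
    have a2 := (isLittleO_log_rpow_atTop hη0).tendsto_div_nhds_zero
    have a3 := a1.add a2
    rw [add_zero] at a3
    refine a3.congr' ?_
    filter_upwards [eventually_gt_atTop 0] with x hx
    rw [Real.rpow_neg hx.le, div_eq_inv_mul]; ring
  refine squeeze_zero' ?_ ?_ (h1.comp tendsto_natCast_atTop_atTop)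
  · filter_upwards [eventually_ge_atTop 1] with M hM
    exact mul_nonneg (coef_nonneg _ _) (growth_nonneg _ _ (by exact_mod_cast hM))
  · filter_upwards [eventually_ge_atTop 1] with M hM
    have hM' : (0 : ℝ) < M := by exact_mod_cast hM
    have hl : 0 ≤ Real.log M := Real.log_natCast_nonneg M
    simp only [Function.comp, coef, growth]
    rw [one_div, ← Real.rpow_neg hM'.le, ← mul_assoc, ← Real.rpow_add hM',
      show -(2 * s) + α = -η by rw [hη]; ring]
    gcongr
    calc (1 + Real.log M) ^ κ ≤ (1 + Real.log M) ^ (1 : ℝ) := by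
          apply Real.rpow_le_rpow_of_exponent_le <;> linarith
      _ = _ := Real.rpow_one _

/-! ### Identification of the high-pass filters -/

/-- The frequencies of `riemannFn`. -/
def sqFreq (n : ℕ) : ℤ := ((n : ℤ) + 1) ^ 2

lemma sqFreq_injective : Function.Injective sqFreq := by
  intro m n h
  unfold sqFreq at h
  have := (sq_eq_sq₀ (by positivity) (by positivity)).1 h
  omega

lemma orthonormal_sqFreq : Orthonormal ℂ (fun n => (fourierLp 2 (sqFreq n) : L2Torus)) :=
  orthonormal_fourier.comp sqFreq sqFreq_injective

lemma summable_smul_sqFreq {c : ℕ → ℂ} (hc : Summable fun n => ‖c n‖ ^ 2) :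
    Summable fun n => c n • (fourierLp 2 (sqFreq n) : L2Torus) :=
  (orthonormal_sqFreq.orthogonalFamily.summable_iff_norm_sq_summable c).2 hc

lemma summable_coef_sq {s : ℝ} (hs : 1 / 4 < s) :
    Summable fun n : ℕ => ‖((coef s (n + 1) : ℝ) : ℂ)‖ ^ 2 := by
  have h : Summable fun n : ℕ => 1 / (n : ℝ) ^ (4 * s) :=
    Real.summable_one_div_nat_rpow.2 (by linarith)
  refine ((summable_nat_add_iff 1).2 h).congr fun n => ?_
  rw [Complex.norm_real, Real.norm_eq_abs, sq_abs, coef, div_pow, one_pow, ← Real.rpow_natCast,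
    ← Real.rpow_mul (by positivity)]
  congr 2
  push_cast; ring

lemma hasSum_riemannFn {s : ℝ} (hs : 1 / 4 < s) :
    HasSum (fun n : ℕ => (coef s (n + 1) : ℂ) • (fourierLp 2 (sqFreq n) : L2Torus))
      (riemannFn s) := by
  have := (summable_smul_sqFreq (summable_coef_sq hs)).hasSum
  convert this using 1
  unfold riemannFn coef sqFreq
  push_cast
  rfl

lemma fourierCoeff_eq_inner (f : L2Torus) (k : ℤ) :
    fourierCoeff f k = inner ℂ (fourierLp 2 k : L2Torus) f := by
  rw [← fourierBasis_repr, fourierBasis.repr_apply_apply, coe_fourierBasis]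

lemma hasSum_fourierCoeff_riemannFn {s : ℝ} (hs : 1 / 4 < s) (k : ℤ) :
    HasSum (fun n : ℕ => (coef s (n + 1) : ℂ) * if k = sqFreq n then 1 else 0)
      (fourierCoeff (riemannFn s) k) := by
  rw [fourierCoeff_eq_inner]
  have h : HasSum (fun n : ℕ => inner ℂ (fourierLp 2 k : L2Torus)
      ((coef s (n + 1) : ℂ) • (fourierLp 2 (sqFreq n) : L2Torus)))
      (inner ℂ (fourierLp 2 k : L2Torus) (riemannFn s)) :=
    (hasSum_riemannFn hs).mapL (innerSL ℂ (fourierLp 2 k : L2Torus))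
  refine Eq.subst (motive := fun g => HasSum g _) (funext fun n => ?_) h
  rw [inner_smul_right]
  congr 1
  exact orthonormal_iff_ite.1 orthonormal_fourier k (sqFreq n)

lemma fourierCoeff_riemannFn_sqFreq {s : ℝ} (hs : 1 / 4 < s) (m : ℕ) :
    fourierCoeff (riemannFn s) (sqFreq m) = coef s (m + 1) := by
  refine (hasSum_fourierCoeff_riemannFn hs (sqFreq m)).unique ?_
  convert hasSum_single m fun n hn => ?_ using 1
  · simp
  · rw [if_neg fun h => hn (sqFreq_injective h).symm, mul_zero]

lemma fourierCoeff_riemannFn_of_notMem {s : ℝ} (hs : 1 / 4 < s) {k : ℤ}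
    (hk : k ∉ Set.range sqFreq) : fourierCoeff (riemannFn s) k = 0 := by
  refine (hasSum_fourierCoeff_riemannFn hs k).unique ?_
  refine Eq.subst (motive := fun g => HasSum g (0 : ℂ)) (funext fun n => ?_) hasSum_zero
  rw [if_neg fun h => hk ⟨n, h.symm⟩, mul_zero]

/-- The smallest positive integer whose square is at least `N`. -/
def cutoff (N : ℕ) : ℕ := Nat.sqrt (N - 1) + 1

/-- Also right at `N = 0`: truncated subtraction gives `cutoff 0 = 1`, where the series starts. -/
lemma le_sqFreq_iff (N n : ℕ) : (N : ℤ) ≤ |sqFreq n| ↔ cutoff N ≤ n + 1 := by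
  have h1 : |sqFreq n| = (((n + 1) ^ 2 : ℕ) : ℤ) := by
    rw [sqFreq, abs_of_nonneg (by positivity)]; push_cast; rfl
  rw [h1, cutoff, Nat.cast_le, Nat.succ_le_succ_iff, ← Nat.lt_succ_iff (n := n), Nat.sqrt_lt']
  have : 0 < (n + 1) ^ 2 := by positivity
  rw [Nat.succ_eq_add_one]
  omega

lemma one_le_cutoff (N : ℕ) : 1 ≤ cutoff N := Nat.succ_pos _

lemma le_cutoff_sq {N : ℕ} : N ≤ cutoff N ^ 2 := by
  have := Nat.lt_succ_sqrt' (N - 1)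
  rw [Nat.succ_eq_add_one] at this
  unfold cutoff
  omega

lemma cutoff_sq_le {N : ℕ} (hN : 1 ≤ N) : cutoff N ^ 2 ≤ 4 * N := by
  obtain ⟨m, rfl⟩ := Nat.exists_eq_add_of_le' hN
  have := Nat.sqrt_le' m
  have := Nat.sqrt_le_self m
  rw [cutoff, Nat.add_sub_cancel]
  nlinarith

lemma tendsto_cutoff : Tendsto cutoff atTop atTop := by
  rw [tendsto_atTop]
  intro b
  filter_upwards [eventually_ge_atTop (b ^ 2)] with N hN
  exact (Nat.pow_le_pow_iff_left two_ne_zero).1 (hN.trans le_cutoff_sq)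

/-- The sum over `ℤ` is supported on squares, so it reindexes along `sqFreq`; summability then
permits partial sums in increasing order. -/
lemma tendsto_truncLp_highPass {s : ℝ} (hs : 1 / 4 < s) (N : ℕ) :
    Tendsto (fun K => truncLp 2 s (cutoff N) K) atTop (nhds (highPass (riemannFn s) N)) := by
  set g : ℤ → L2Torus := fun k =>
    if (N : ℤ) ≤ |k| then fourierCoeff (riemannFn s) k • (fourierLp 2 k : L2Torus) else 0 with hg
  set c : ℕ → ℂ := fun n => if cutoff N ≤ n + 1 then (coef s (n + 1) : ℂ) else 0 with hc
  have hgc : ∀ n, g (sqFreq n) = c n • (fourierLp 2 (sqFreq n) : L2Torus) := by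
    intro n
    simp only [hg, hc, le_sqFreq_iff]
    split_ifs
    · rw [fourierCoeff_riemannFn_sqFreq hs]
    · rw [zero_smul]
  have hsupp : Function.support g ⊆ Set.range sqFreq := by
    intro k hk
    by_contra hc
    apply hk
    simp only [hg]
    rw [fourierCoeff_riemannFn_of_notMem hs hc, zero_smul, ite_self]
  have htsum : highPass (riemannFn s) N = ∑' n, c n • (fourierLp 2 (sqFreq n) : L2Torus) := by
    have := sqFreq_injective.tsum_eq hsupp
    rw [show highPass (riemannFn s) N = ∑' k, g k from rfl, ← this]
    exact tsum_congr hgc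
  have hsum : Summable fun n => c n • (fourierLp 2 (sqFreq n) : L2Torus) := by
    apply summable_smul_sqFreq
    refine (summable_coef_sq hs).of_nonneg_of_le (fun n => by positivity) fun n => ?_
    simp only [hc]
    split_ifs
    · rfl
    · rw [norm_zero, zero_pow two_ne_zero]; positivity
  rw [htsum, ← tendsto_add_atTop_iff_nat 1]
  refine hsum.hasSum.tendsto_sum_nat.congr fun K => ?_
  have h1 := one_le_cutoff N
  rw [truncLp]
  have e : ∑ n ∈ Finset.Ico (cutoff N) (K + 1), (coef s n : ℂ) • (fourierLp 2 ((n : ℤ) ^ 2) : L2Torus)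
      = ∑ n ∈ Finset.Ico 1 (K + 1), if cutoff N ≤ n then
        (coef s n : ℂ) • (fourierLp 2 ((n : ℤ) ^ 2) : L2Torus) else 0 := by
    rw [← Finset.sum_filter]
    congr 1
    ext n
    simp only [Finset.mem_filter, Finset.mem_Ico]
    omega
  rw [e, Finset.sum_Ico_eq_sum_range, Nat.add_sub_cancel]
  refine Finset.sum_congr rfl fun n _ => ?_
  rw [add_comm 1 n]
  simp only [hc, sqFreq]
  split_ifs
  · push_cast; rfl
  · rw [zero_smul]

lemma highPass_zero (f : L2Torus) : highPass f 0 = f := by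
  have : highPass f 0 = ∑' n : ℤ, fourierCoeff f n • (fourierLp 2 n : L2Torus) := by
    unfold highPass
    refine tsum_congr fun n => ?_
    rw [if_pos (by simp)]
  rw [this, (hasSum_fourier_series_L2 f).tsum_eq]

lemma coeFn_truncLp (P : ENNReal) [Fact (1 ≤ P)] (s : ℝ) (M K : ℕ) :
    (truncLp P s M K : AddCircle (1 : ℝ) → ℂ) =ᵐ[haarAddCircle]
      fun x => ∑ n ∈ Finset.Ico M K, (coef s n : ℂ) * fourier ((n : ℤ) ^ 2) x :=
  coeFn_sum_fourierLp _ _ _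

/-- The tail bound makes the truncations Cauchy in `L^p`. Their `L^p` and `L²` limits agree almost
everywhere, both being limits in measure of the same trigonometric polynomials. -/
lemma memLp_highPass_and_tendsto {p s : ℝ} (hp : 2 < p) (hs : sStar p < s)
    [Fact (1 ≤ ENNReal.ofReal p)] (N : ℕ) :
    MemLp (highPass (riemannFn s) N) (ENNReal.ofReal p) haarAddCircle ∧
    Tendsto (fun K => ‖truncLp (ENNReal.ofReal p) s (cutoff N) K‖) atTop
      (nhds (normLp p (highPass (riemannFn s) N))) := by
  have hs4 : 1 / 4 < s := by
    have h := lengthExp_lt_of_sStar_lt hs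
    unfold lengthExp at h
    split_ifs at h with h4
    · linarith
    · push Not at h4
      have : 2 / p ≤ 1 / 2 := by rw [div_le_div_iff₀ (by linarith) (by norm_num)]; linarith
      linarith
  obtain ⟨C, hC, hbound⟩ := exists_norm_truncLp_le hp hs
  set P := ENNReal.ofReal p
  have hlim := (tendsto_coef_mul_growth (logExp_le_one p) (lengthExp_lt_of_sStar_lt hs)).const_mul C
  rw [mul_zero] at hlim
  -- The maximum keeps the upper end at or above `cutoff N`, so that consecutive intervals can be
  -- split for every index.
  have hcauchy : CauchySeq fun K => truncLp P s (cutoff N) (max K (cutoff N)) := by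
    refine cauchySeq_of_le_tendsto_0'
      (fun K => C * (coef s (max K (cutoff N)) * growth (lengthExp p) (logExp p) (max K (cutoff N) : ℕ)))
      ?_ ?_
    · intro n m hnm
      have h1 : truncLp P s (cutoff N) (max m (cutoff N)) = truncLp P s (cutoff N) (max n (cutoff N))
          + truncLp P s (max n (cutoff N)) (max m (cutoff N)) :=
        (Finset.sum_Ico_consecutive _ (by omega) (by omega)).symm
      rw [h1, dist_self_add_right]
      exact hbound _ _ ((one_le_cutoff N).trans (le_max_right _ _))
    · exact hlim.comp (tendsto_atTop_mono (fun n => le_max_left n (cutoff N)) tendsto_id)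
  obtain ⟨F, hF⟩ := cauchySeq_tendsto_of_complete hcauchy
  have hF' : Tendsto (fun K => truncLp P s (cutoff N) K) atTop (nhds F) := by
    refine hF.congr' ?_
    filter_upwards [eventually_ge_atTop (cutoff N)] with K hK
    rw [max_eq_left hK]
  have m1 := tendstoInMeasure_of_tendsto_Lp hF'
  have m2 := tendstoInMeasure_of_tendsto_Lp (tendsto_truncLp_highPass hs4 N)
  have m3 : TendstoInMeasure haarAddCircle
      (fun K => (truncLp P s (cutoff N) K : AddCircle (1 : ℝ) → ℂ)) atTop
      (highPass (riemannFn s) N) :=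
    m2.congr_left fun K => (coeFn_truncLp 2 s (cutoff N) K).trans (coeFn_truncLp P s (cutoff N) K).symm
  have hae := tendstoInMeasure_ae_unique m1 m3
  refine ⟨(memLp_congr_ae hae).1 (Lp.memLp F), ?_⟩
  have : normLp p (highPass (riemannFn s) N) = ‖F‖ := by
    rw [normLp, Lp.norm_def, eLpNorm_congr_ae hae]
  rw [this]
  exact hF'.norm

lemma exists_normLp_highPass_le {p s : ℝ} (hp : 2 < p) (hs : sStar p < s) :
    ∃ C, 0 ≤ C ∧ ∀ N : ℕ, normLp p (highPass (riemannFn s) N)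
      ≤ C * (coef s (cutoff N) * growth (lengthExp p) (logExp p) (cutoff N)) := by
  have : Fact (1 ≤ ENNReal.ofReal p) := ⟨by
    rw [← ENNReal.ofReal_one]; exact ENNReal.ofReal_le_ofReal (by linarith)⟩
  obtain ⟨C, hC, hbound⟩ := exists_norm_truncLp_le hp hs
  exact ⟨C, hC, fun N => le_of_tendsto (memLp_highPass_and_tendsto hp hs N).2
    (Eventually.of_forall fun K => hbound _ _ (one_le_cutoff N))⟩

lemma normLp_two_eq_norm (f : L2Torus) : normLp 2 f = ‖f‖ := by
  rw [normLp, Lp.norm_def, ENNReal.ofReal_ofNat]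

lemma coef_mul (s : ℝ) (a M : ℕ) : coef s (a * M) = (a : ℝ) ^ (-(2 * s)) * coef s M := by
  unfold coef
  push_cast
  rw [Real.mul_rpow (by positivity) (by positivity), one_div, mul_inv,
    ← Real.rpow_neg (by positivity), one_div]

lemma le_norm_truncLp_two {s : ℝ} (hs : 0 ≤ s) {M K : ℕ} (hM : 1 ≤ M) (hK : 2 * M ≤ K) :
    2 ^ (-(2 * s)) * (coef s M * (M : ℝ) ^ (1 / 2 : ℝ)) ≤ ‖truncLp 2 s M K‖ := by
  have h1 : ‖truncLp 2 s M K‖ ^ 2 = ∑ n ∈ Finset.Ico M K, coef s n ^ 2 := by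
    have ho : Orthonormal ℂ (fun n : ℕ => (fourierLp 2 ((n : ℤ) ^ 2) : L2Torus)) :=
      orthonormal_fourier.comp _ fun m n h => by
        have := (sq_eq_sq₀ (by positivity) (by positivity)).1 h
        omega
    have h2 := ho.inner_sum (fun n => (coef s n : ℂ)) (fun n => (coef s n : ℂ)) (Finset.Ico M K)
    rw [inner_self_eq_norm_sq_to_K] at h2
    have h3 : ((‖truncLp 2 s M K‖ ^ 2 : ℝ) : ℂ) = ((∑ n ∈ Finset.Ico M K, coef s n ^ 2 : ℝ) : ℂ) := by
      push_cast
      refine Eq.trans h2 (Finset.sum_congr rfl fun n _ => ?_)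
      rw [Complex.conj_ofReal, sq]
    exact_mod_cast h3
  have h2 : (2 ^ (-(2 * s)) * (coef s M * (M : ℝ) ^ (1 / 2 : ℝ))) ^ 2
      ≤ ∑ n ∈ Finset.Ico M K, coef s n ^ 2 := by
    calc _ = ∑ n ∈ Finset.Ico M (2 * M), coef s (2 * M) ^ 2 := by
          rw [Finset.sum_const, Nat.card_Ico, nsmul_eq_mul, coef_mul, mul_pow, mul_pow, mul_pow,
            ← Real.rpow_natCast ((M : ℝ) ^ (1 / 2 : ℝ)), ← Real.rpow_mul (by positivity),
            show 2 * M - M = M by omega]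
          norm_num
          ring
      _ ≤ ∑ n ∈ Finset.Ico M (2 * M), coef s n ^ 2 := by
          refine Finset.sum_le_sum fun n hn => ?_
          rw [Finset.mem_Ico] at hn
          have := coef_nonneg s (2 * M)
          gcongr
          exact coef_anti hs (by omega) hn.2.le
      _ ≤ _ := Finset.sum_le_sum_of_subset_of_nonneg (Finset.Ico_subset_Ico_right hK)
          (fun _ _ _ => by positivity)
  rw [← h1] at h2
  exact le_of_sq_le_sq h2 (norm_nonneg _)

lemma le_normLp_two_highPass {s : ℝ} (hs : 1 / 4 < s) (N : ℕ) :
    2 ^ (-(2 * s)) * (coef s (cutoff N) * (cutoff N : ℝ) ^ (1 / 2 : ℝ))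
      ≤ normLp 2 (highPass (riemannFn s) N) := by
  rw [normLp_two_eq_norm]
  refine ge_of_tendsto (tendsto_truncLp_highPass hs N).norm ?_
  filter_upwards [eventually_ge_atTop (2 * cutoff N)] with K hK
  exact le_norm_truncLp_two (by linarith) (one_le_cutoff N) hK

lemma normLp_mono {p q : ℝ} (hpq : p ≤ q) {f : AddCircle (1 : ℝ) → ℂ}
    (hf : MemLp f (ENNReal.ofReal q) haarAddCircle) : normLp p f ≤ normLp q f := by
  unfold normLp
  exact ENNReal.toReal_mono hf.2.ne
    (eLpNorm_le_eLpNorm_of_exponent_le (ENNReal.ofReal_le_ofReal hpq) hf.1)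

/-! ### The lower bound for `p = 4` -/

/-- Insert `n = ∑_{d ∣ n} φ(d)` into `1/n = n/n²` and exchange sums: the multiples of `d` contribute
at most `4/d²`. This replaces any asymptotics for `φ`. -/
lemma log_le_sum_totient (X : ℕ) :
    Real.log (X + 1) ≤ 4 * ∑ d ∈ Finset.Icc 1 X, (Nat.totient d : ℝ) / (d : ℝ) ^ 2 := by
  have h1 : Real.log (X + 1) ≤ ∑ n ∈ Finset.Icc 1 X, (n : ℝ)⁻¹ := by
    have := log_add_one_le_harmonic X
    rw [harmonic_eq_sum_Icc] at this
    push_cast at this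
    exact this
  have h2 : ∑ n ∈ Finset.Icc 1 X, (n : ℝ)⁻¹
      = ∑ n ∈ Finset.Icc 1 X, ∑ d ∈ n.divisors, (Nat.totient d : ℝ) * (1 / (n : ℝ) ^ 2) := by
    refine Finset.sum_congr rfl fun n hn => ?_
    have hn0 : (n : ℝ) ≠ 0 := by
      have := (Finset.mem_Icc.1 hn).1
      positivity
    rw [← Finset.sum_mul, ← Nat.cast_sum, Nat.sum_totient]
    field_simp
  have h3 : ∑ n ∈ Finset.Icc 1 X, ∑ d ∈ n.divisors, (Nat.totient d : ℝ) * (1 / (n : ℝ) ^ 2)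
      = ∑ d ∈ Finset.Icc 1 X, ∑ n ∈ (Finset.Icc 1 X).filter (d ∣ ·),
        (Nat.totient d : ℝ) * (1 / (n : ℝ) ^ 2) := by
    apply Finset.sum_comm'
    intro n d
    simp only [Finset.mem_Icc, Nat.mem_divisors, Finset.mem_filter]
    constructor
    · rintro ⟨⟨a, b⟩, c, _⟩
      exact ⟨⟨⟨a, b⟩, c⟩, Nat.pos_of_dvd_of_pos c a, (Nat.le_of_dvd a c).trans b⟩
    · rintro ⟨⟨⟨a, b⟩, c⟩, _⟩
      exact ⟨⟨a, b⟩, c, by omega⟩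
  rw [h2, h3] at h1
  refine h1.trans ?_
  rw [Finset.mul_sum]
  refine Finset.sum_le_sum fun d hd => ?_
  have hd0 : 0 < d := (Finset.mem_Icc.1 hd).1
  have hd' : (0 : ℝ) < d := by exact_mod_cast hd0
  rw [← Finset.mul_sum]
  have h4 : ∑ n ∈ (Finset.Icc 1 X).filter (d ∣ ·), 1 / (n : ℝ) ^ 2 ≤ 4 / (d : ℝ) ^ 2 := by
    calc _ ≤ ∑ n ∈ (Finset.range X).image (fun m => d * (m + 1)), 1 / (n : ℝ) ^ 2 := by
          apply Finset.sum_le_sum_of_subset_of_nonneg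
          · intro n hn
            simp only [Finset.mem_filter, Finset.mem_Icc] at hn
            obtain ⟨⟨a, b⟩, k, rfl⟩ := hn
            rw [Finset.mem_image]
            have hk : 0 < k := Nat.pos_of_mul_pos_left a
            refine ⟨k - 1, ?_, by rw [Nat.sub_add_cancel hk]⟩
            rw [Finset.mem_range]
            have : k ≤ d * k := Nat.le_mul_of_pos_left k hd0
            omega
          · intro _ _ _; positivity
      _ = ∑ m ∈ Finset.range X, 1 / (d : ℝ) ^ 2 * (1 / ((m : ℝ) + 1) ^ 2) := by
          rw [Finset.sum_image fun m _ n _ h => by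
            have := Nat.eq_of_mul_eq_mul_left hd0 h
            omega]
          refine Finset.sum_congr rfl fun m _ => ?_
          push_cast
          field_simp
      _ ≤ 1 / (d : ℝ) ^ 2 * 4 := by
          rw [← Finset.mul_sum]
          gcongr
          exact sum_range_one_div_sq_le X
      _ = 4 / (d : ℝ) ^ 2 := by ring
  calc _ ≤ (Nat.totient d : ℝ) * (4 / (d : ℝ) ^ 2) := by gcongr
    _ = _ := by ring

/-- Pairs of pairs in `[M, 7M)` whose sums of squares agree. -/
def quadruples (M : ℕ) : Finset ((ℕ × ℕ) × (ℕ × ℕ)) :=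
  ((Finset.Ico M (7 * M) ×ˢ Finset.Ico M (7 * M)) ×ˢ
    (Finset.Ico M (7 * M) ×ˢ Finset.Ico M (7 * M))).filter
      fun a => a.1.1 ^ 2 + a.1.2 ^ 2 = a.2.1 ^ 2 + a.2.2 ^ 2

lemma eq_and_eq_of_mul_eq_mul_of_coprime {i j i' j' : ℕ} (h : Nat.Coprime i j)
    (h' : Nat.Coprime i' j') (e : j * i' = j' * i) : i = i' ∧ j = j' := by
  constructor
  · apply Nat.dvd_antisymm
    · exact h.dvd_of_dvd_mul_left (Dvd.intro_left _ e.symm)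
    · exact h'.dvd_of_dvd_mul_left (Dvd.intro_left _ e)
  · apply Nat.dvd_antisymm
    · exact h.symm.dvd_of_dvd_mul_right (Dvd.intro _ e)
    · exact h'.symm.dvd_of_dvd_mul_right (Dvd.intro _ e.symm)

/-- Uses `(jt + gi)² + (it - gj)² = (jt - gi)² + (it + gj)²` with `i ≤ j < 2i` coprime, `2M ≤ it ≤
3M` and `2ig ≤ M`, which keeps all entries in `[M, 7M)`. Sums and differences of entries recover
`jt`, `it`, `gi`, and the reduced ratio `i : j` then determines every parameter. -/
lemma sum_totient_mul_le_card_quadruples {M : ℕ} (hM : 0 < M) :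
    ∑ i ∈ Finset.Icc 1 (M / 2), Nat.totient i * ((M / i) * (M / (2 * i)))
      ≤ (quadruples M).card := by
  set T : Finset (Σ _ : ℕ, ℕ × ℕ × ℕ) := (Finset.Icc 1 (M / 2)).sigma fun i =>
    ((Finset.Ico i (i + i)).filter (Nat.Coprime i)) ×ˢ
      (Finset.range (M / i) ×ˢ Finset.Icc 1 (M / (2 * i))) with hT
  have hcard : T.card = ∑ i ∈ Finset.Icc 1 (M / 2), Nat.totient i * ((M / i) * (M / (2 * i))) := by
    rw [hT, Finset.card_sigma]
    refine Finset.sum_congr rfl fun i _ => ?_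
    rw [Finset.card_product, Finset.card_product, Nat.filter_coprime_Ico_eq_totient,
      Finset.card_range, Nat.card_Icc, Nat.add_sub_cancel]
  rw [← hcard]
  -- The parameter `t` is `⌈2M / i⌉ + u`; with `u < M / i` this gives `2M ≤ it ≤ 3M`.
  set τ : (Σ _ : ℕ, ℕ × ℕ × ℕ) → ℕ := fun y => (2 * M + y.1 - 1) / y.1 + y.2.2.1 with hτ
  have hmem : ∀ y ∈ T, 1 ≤ y.1 ∧ y.1 ≤ y.2.1 ∧ y.2.1 < 2 * y.1 ∧ Nat.Coprime y.1 y.2.1 ∧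
      2 * M ≤ y.1 * τ y ∧ y.1 * τ y ≤ 3 * M ∧ 1 ≤ y.2.2.2 ∧ 2 * y.1 * y.2.2.2 ≤ M ∧ 1 ≤ τ y := by
    rintro ⟨i, j, u, g⟩ hy
    simp only [hT, Finset.mem_sigma, Finset.mem_product, Finset.mem_filter, Finset.mem_Ico,
      Finset.mem_range, Finset.mem_Icc] at hy
    obtain ⟨⟨hi1, hi2⟩, ⟨⟨hj1, hj2⟩, hco⟩, hu, hg1, hg2⟩ := hy
    simp only [hτ]
    have a1 : 2 * M ≤ i * ((2 * M + i - 1) / i) := by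
      have := Nat.lt_mul_div_succ (2 * M + i - 1) (by omega : 0 < i)
      rw [mul_add, mul_one] at this
      omega
    have a2 : i * ((2 * M + i - 1) / i) ≤ 2 * M + i - 1 := Nat.mul_div_le _ _
    have a3 : i * u + i ≤ M := by
      calc i * u + i = i * (u + 1) := by ring
        _ ≤ i * (M / i) := Nat.mul_le_mul_left _ hu
        _ ≤ M := Nat.mul_div_le _ _
    have a4 : 2 * i * g ≤ M := (Nat.mul_le_mul_left _ hg2).trans (Nat.mul_div_le _ _)
    refine ⟨hi1, hj1, by omega, hco, ?_, ?_, hg1, a4, ?_⟩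
    · rw [mul_add]; omega
    · rw [mul_add]; omega
    · rcases Nat.eq_zero_or_pos ((2 * M + i - 1) / i) with h0 | h0
      · rw [h0] at a1; omega
      · exact h0.trans_le (Nat.le_add_right _ _)
  apply Finset.card_le_card_of_injOn fun y =>
    ((y.2.1 * τ y + y.2.2.2 * y.1, y.1 * τ y - y.2.2.2 * y.2.1),
      (y.2.1 * τ y - y.2.2.2 * y.1, y.1 * τ y + y.2.2.2 * y.2.1))
  · intro y hy
    obtain ⟨h1, h2, h3, h4, h5, h6, h7, h8, h9⟩ := hmem y hy
    obtain ⟨i, j, u, g⟩ := y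
    simp only at h1 h2 h3 h4 h5 h6 h7 h8 h9 ⊢
    generalize τ ⟨i, j, u, g⟩ = t at *
    have b1 : i * t ≤ j * t := Nat.mul_le_mul_right _ h2
    have b2 : j * t ≤ 2 * (i * t) := by
      calc j * t ≤ 2 * i * t := Nat.mul_le_mul_right _ h3.le
        _ = _ := by ring
    have b3 : g * j ≤ M := by
      calc g * j ≤ g * (2 * i) := Nat.mul_le_mul_left _ h3.le
        _ = 2 * i * g := by ring
        _ ≤ M := h8
    have b4 : g * i ≤ g * j := Nat.mul_le_mul_left _ h2
    have b5 : 2 * (g * i) ≤ M := by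
      calc 2 * (g * i) = 2 * i * g := by ring
        _ ≤ M := h8
    have b6 : g * j < 2 * (g * i) := by
      calc g * j < g * (2 * i) := Nat.mul_lt_mul_of_pos_left h3 h7
        _ = _ := by ring
    simp only [quadruples, Finset.coe_filter, Finset.mem_product, Finset.mem_Ico, Set.mem_ofPred_eq]
    refine ⟨⟨⟨⟨?_, ?_⟩, ?_, ?_⟩, ⟨?_, ?_⟩, ?_, ?_⟩, ?_⟩ <;> try omega
    zify [(by omega : g * j ≤ i * t), (by omega : g * i ≤ j * t)]
    ring
  · intro y hy y' hy' hyy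
    obtain ⟨h1, h2, h3, h4, h5, h6, h7, h8, h9⟩ := hmem y hy
    obtain ⟨h1', h2', h3', h4', h5', h6', h7', h8', h9'⟩ := hmem y' hy'
    obtain ⟨i, j, u, g⟩ := y
    obtain ⟨i', j', u', g'⟩ := y'
    simp only [Prod.mk.injEq] at hyy
    have hτ1 : τ ⟨i, j, u, g⟩ = (2 * M + i - 1) / i + u := rfl
    have hτ2 : τ ⟨i', j', u', g'⟩ = (2 * M + i' - 1) / i' + u' := rfl
    simp only at h1 h2 h3 h4 h5 h6 h7 h8 h9 h1' h2' h3' h4' h5' h6' h7' h8' h9'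
    generalize τ ⟨i, j, u, g⟩ = t at *
    generalize τ ⟨i', j', u', g'⟩ = t' at *
    have bound : ∀ {i j g t : ℕ}, i ≤ j → j < 2 * i → 2 * M ≤ i * t → 2 * i * g ≤ M →
        g * j ≤ i * t ∧ g * i ≤ j * t := by
      intro i j g t a b c d
      have b1 : i * t ≤ j * t := Nat.mul_le_mul_right _ a
      have b3 : g * j ≤ M := by
        calc g * j ≤ g * (2 * i) := Nat.mul_le_mul_left _ b.le
          _ = 2 * i * g := by ring
          _ ≤ M := d
      have b4 : g * i ≤ g * j := Nat.mul_le_mul_left _ a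
      omega
    obtain ⟨c1, c2⟩ := bound h2 h3 h5 h8
    obtain ⟨c1', c2'⟩ := bound h2' h3' h5' h8'
    obtain ⟨⟨e1, e2⟩, e3, e4⟩ := hyy
    have f1 : j * t = j' * t' := by omega
    have f2 : i * t = i' * t' := by omega
    have f3 : g * i = g' * i' := by omega
    have f4 : j * i' = j' * i := by
      have ht : 0 < t * t' := Nat.mul_pos h9 h9'
      apply Nat.eq_of_mul_eq_mul_right ht
      calc j * i' * (t * t') = (j * t) * (i' * t') := by ring
        _ = (j' * t') * (i * t) := by rw [f1, f2]
        _ = j' * i * (t * t') := by ring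
    obtain ⟨rfl, rfl⟩ := eq_and_eq_of_mul_eq_mul_of_coprime h4 h4' f4
    have f5 : t = t' := Nat.eq_of_mul_eq_mul_left h1 f2
    have f6 : g = g' := Nat.eq_of_mul_eq_mul_right h1 f3
    have f7 : u = u' := by omega
    rw [f6, f7]

lemma sq_mul_log_le_card_quadruples {M : ℕ} (hM : 4 ≤ M) :
    (M : ℝ) ^ 2 * Real.log M / 64 ≤ (quadruples M).card := by
  have h1 : ((∑ i ∈ Finset.Icc 1 (M / 2), Nat.totient i * ((M / i) * (M / (2 * i))) : ℕ) : ℝ)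
      ≤ (quadruples M).card := by
    exact_mod_cast sum_totient_mul_le_card_quadruples (by omega)
  refine le_trans ?_ h1
  -- The floor costs at most a factor `2` while `k ≤ M`; the range `i ≤ M / 2` allows both `k = i`
  -- and `k = 2i`.
  have half : ∀ k : ℕ, 1 ≤ k → k ≤ M → (M : ℝ) / (2 * k) ≤ ((M / k : ℕ) : ℝ) := by
    intro k hk hkM
    have hk' : (0 : ℝ) < k := by exact_mod_cast hk
    rw [div_le_iff₀ (by positivity)]
    have a1 := Nat.lt_mul_div_succ M hk
    have a2 : 1 ≤ M / k := (Nat.one_le_div_iff hk).2 hkM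
    have : M ≤ (M / k) * (2 * k) := by nlinarith
    exact_mod_cast this
  have h2 := log_le_sum_totient (M / 2)
  have h3 : Real.log M / 2 ≤ Real.log ((M / 2 : ℕ) + 1) := by
    have hMr : (4 : ℝ) ≤ M := by exact_mod_cast hM
    have a1 : (M : ℝ) / 2 ≤ (M / 2 : ℕ) + 1 := by
      have : M ≤ 2 * (M / 2 + 1) := by omega
      have : (M : ℝ) ≤ 2 * ((M / 2 : ℕ) + 1) := by exact_mod_cast this
      linarith
    have a2 : Real.log M ≤ 2 * Real.log ((M / 2 : ℕ) + 1) := by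
      rw [← Real.log_rpow (by positivity)]
      apply Real.log_le_log (by linarith)
      have : ((M : ℝ) / 2) ^ (2 : ℕ) ≤ (((M / 2 : ℕ) : ℝ) + 1) ^ (2 : ℕ) := by gcongr
      rw [Real.rpow_ofNat]
      nlinarith
    linarith
  calc (M : ℝ) ^ 2 * Real.log M / 64 = (M : ℝ) ^ 2 / 32 * (Real.log M / 2) := by ring
    _ ≤ (M : ℝ) ^ 2 / 32 * (4 * ∑ d ∈ Finset.Icc 1 (M / 2), (Nat.totient d : ℝ) / (d : ℝ) ^ 2) := by
        gcongr; exact h3.trans h2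
    _ = ∑ d ∈ Finset.Icc 1 (M / 2), (Nat.totient d : ℝ) * ((M / (2 * d)) * (M / (2 * (2 * d)))) := by
        rw [Finset.mul_sum, Finset.mul_sum]
        refine Finset.sum_congr rfl fun d hd => ?_
        have : (d : ℝ) ≠ 0 := by
          have := (Finset.mem_Icc.1 hd).1
          positivity
        field_simp
        ring
    _ ≤ _ := by
        push_cast
        refine Finset.sum_le_sum fun d hd => ?_
        rw [Finset.mem_Icc] at hd
        have b1 := half d hd.1 (by omega)
        have b2 := half (2 * d) (by omega) (by omega)
        push_cast at b1 b2
        gcongr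

/-- Frequencies may repeat, so the right side counts coincidences; this is needed for sums over
pairs. -/
lemma norm_sq_sum_fourierLp {ι : Type*} (I : Finset ι) (w : ι → ℝ) (k : ι → ℤ) :
    ‖∑ n ∈ I, (w n : ℂ) • (fourierLp 2 (k n) : L2Torus)‖ ^ 2
      = ∑ m ∈ I, ∑ n ∈ I, w m * w n * if k m = k n then 1 else 0 := by
  set v : L2Torus := ∑ n ∈ I, (w n : ℂ) • (fourierLp 2 (k n) : L2Torus) with hv
  have h : ((‖v‖ ^ 2 : ℝ) : ℂ)
      = ((∑ m ∈ I, ∑ n ∈ I, w m * w n * if k m = k n then 1 else 0 : ℝ) : ℂ) := by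
    push_cast
    refine (inner_self_eq_norm_sq_to_K (𝕜 := ℂ) v).symm.trans ?_
    rw [hv, sum_inner]
    refine Finset.sum_congr rfl fun m _ => ?_
    rw [inner_sum]
    refine Finset.sum_congr rfl fun n _ => ?_
    rw [inner_smul_left, inner_smul_right, Complex.conj_ofReal, mul_assoc]
    congr 2
    rw [orthonormal_iff_ite.1 (orthonormal_fourier (T := (1 : ℝ))) (k m) (k n)]
    split_ifs <;> simp
  exact_mod_cast h

/-- The fourth power of the `L⁴` norm is the squared `L²` norm of the square, a sum over coinciding
frequencies `m² + n²`. All terms are nonnegative, so only those from `quadruples M` are kept. -/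
lemma le_norm_truncLp_four {s : ℝ} (hs : 0 ≤ s) [Fact (1 ≤ ENNReal.ofReal 4)] {M K : ℕ}
    (hM : 4 ≤ M) (hK : 7 * M ≤ K) :
    (7 ^ (-(2 * s)) * coef s M) ^ 4 * ((M : ℝ) ^ 2 * Real.log M / 64)
      ≤ ‖truncLp (ENNReal.ofReal 4) s M K‖ ^ (4 : ℝ) := by
  set I := Finset.Ico M K with hI
  set w : ℕ × ℕ → ℝ := fun a => coef s a.1 * coef s a.2 with hw
  set k : ℕ × ℕ → ℤ := fun a => (a.1 : ℤ) ^ 2 + (a.2 : ℤ) ^ 2 with hk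
  have h1 : ‖truncLp (ENNReal.ofReal 4) s M K‖ ^ (4 : ℝ)
      = ‖∑ a ∈ I ×ˢ I, (w a : ℂ) • (fourierLp 2 (k a) : L2Torus)‖ ^ 2 := by
    have a1 := Lp_norm_rpow_sum_fourierLp (P := 2) (by norm_num) (I ×ˢ I) (fun a => (w a : ℂ)) k
    rw [ENNReal.toReal_ofNat, Real.rpow_ofNat] at a1
    rw [truncLp, Lp_norm_rpow_sum_fourierLp_ofReal (by norm_num), a1]
    refine integral_congr_ae (Eventually.of_forall fun x => ?_)
    simp only
    have a2 : ∑ a ∈ I ×ˢ I, (w a : ℂ) * fourier (k a) x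
        = (∑ n ∈ I, (coef s n : ℂ) * fourier ((n : ℤ) ^ 2) x) ^ 2 := by
      rw [sq, Finset.sum_mul_sum, Finset.sum_product]
      refine Finset.sum_congr rfl fun m _ => Finset.sum_congr rfl fun n _ => ?_
      simp only [hw, hk]
      rw [fourier_add]
      push_cast
      ring
    rw [a2, norm_pow, Real.rpow_ofNat, Real.rpow_ofNat, ← pow_mul]
  rw [h1, norm_sq_sum_fourierLp, ← Finset.sum_product']
  have hc0 := coef_nonneg s (7 * M)
  have h7 : (7 : ℝ) ^ (-(2 * s)) * coef s M = coef s (7 * M) := by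
    rw [coef_mul]; norm_num
  rw [h7]
  calc _ ≤ coef s (7 * M) ^ 4 * (quadruples M).card := by
        gcongr
        exact sq_mul_log_le_card_quadruples hM
    _ = ∑ a ∈ quadruples M, coef s (7 * M) ^ 4 := by
        rw [Finset.sum_const, nsmul_eq_mul]; ring
    _ ≤ ∑ a ∈ quadruples M, w a.1 * w a.2 * if k a.1 = k a.2 then 1 else 0 := by
        refine Finset.sum_le_sum fun a ha => ?_
        simp only [quadruples, Finset.mem_filter, Finset.mem_product, Finset.mem_Ico] at ha
        obtain ⟨⟨⟨⟨p1, p2⟩, p3, p4⟩, ⟨p5, p6⟩, p7, p8⟩, p9⟩ := ha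
        rw [if_pos (by simp only [hk]; exact_mod_cast p9), mul_one]
        have q1 := coef_anti hs (by omega) p2.le
        have q2 := coef_anti hs (by omega) p4.le
        have q3 := coef_anti hs (by omega) p6.le
        have q4 := coef_anti hs (by omega) p8.le
        simp only [hw]
        calc coef s (7 * M) ^ 4 = (coef s (7 * M) * coef s (7 * M)) * (coef s (7 * M) * coef s (7 * M)) := by ring
          _ ≤ _ := by gcongr <;> first | exact coef_nonneg _ _ | exact mul_nonneg (coef_nonneg _ _) (coef_nonneg _ _)
    _ ≤ _ := by
        apply Finset.sum_le_sum_of_subset_of_nonneg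
        · intro a ha
          simp only [quadruples, Finset.mem_filter, Finset.mem_product, Finset.mem_Ico, hI] at ha ⊢
          omega
        · intro a _ _
          have := coef_nonneg s
          simp only [hw]
          split_ifs
          · rw [mul_one]
            exact mul_nonneg (mul_nonneg (this _) (this _)) (mul_nonneg (this _) (this _))
          · rw [mul_zero]

/-! ### The lower bound for `p > 4` -/

lemma memLp_of_continuous {f : AddCircle (1 : ℝ) → ℂ} (hf : Continuous f) (P : ENNReal) :
    MemLp f P haarAddCircle :=
  hf.memLp_of_hasCompactSupport (HasCompactSupport.of_compactSpace _)

/-- Squaring the kernel raises the exponent to `2q ≥ 2`, so the sup bound `J` and Parseval suffice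
even for `q` close to `1`. -/
lemma integral_dirichletKernel_sq_rpow_le {q : ℝ} (hq : 1 ≤ q) (J : ℕ) :
    ∫ x : AddCircle (1 : ℝ), ‖(∑ j ∈ Finset.range J, (fourier (j : ℤ) x : ℂ)) ^ 2‖ ^ q ∂haarAddCircle
      ≤ (J : ℝ) ^ (2 * q - 2) * J := by
  set D : AddCircle (1 : ℝ) → ℂ := fun x => ∑ j ∈ Finset.range J, (fourier (j : ℤ) x : ℂ) with hD
  have hDc : Continuous D := by fun_prop
  have hDJ : ∀ x, ‖D x‖ ≤ J := fun x => by
    calc ‖D x‖ ≤ ∑ j ∈ Finset.range J, (1 : ℝ) := by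
          refine (norm_sum_le _ _).trans (Finset.sum_le_sum fun j _ => ?_)
          rw [fourier_apply]; exact (Circle.norm_coe _).le
      _ = J := by simp
  have h2 : ∫ x, ‖D x‖ ^ 2 ∂haarAddCircle = J := by
    have a1 := Lp_norm_rpow_sum_fourierLp (P := 2) (by norm_num) (Finset.range J)
      (fun _ => ((1 : ℝ) : ℂ)) (fun j : ℕ => (j : ℤ))
    rw [ENNReal.toReal_ofNat, Real.rpow_ofNat, norm_sq_sum_fourierLp (Finset.range J)
      (fun _ => 1) (fun j : ℕ => (j : ℤ))] at a1
    simp only [Complex.ofReal_one, one_mul, Real.rpow_ofNat, Nat.cast_inj] at a1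
    rw [← a1, Finset.sum_congr rfl fun i hi => by rw [Finset.sum_ite_eq, if_pos hi]]
    simp
  have hint : Integrable (fun x => ‖D x‖ ^ 2) haarAddCircle :=
    (hDc.norm.pow 2).integrable_of_hasCompactSupport (HasCompactSupport.of_compactSpace _)
  calc ∫ x, ‖D x ^ 2‖ ^ q ∂haarAddCircle
      ≤ ∫ x, (J : ℝ) ^ (2 * q - 2) * ‖D x‖ ^ 2 ∂haarAddCircle := by
        apply integral_mono_of_nonneg (Eventually.of_forall fun x => by positivity)
          (hint.const_mul _) (Eventually.of_forall fun x => ?_)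
        simp only
        have e : ‖D x ^ 2‖ ^ q = ‖D x‖ ^ (2 * q - 2) * ‖D x‖ ^ 2 := by
          rw [norm_pow, ← Real.rpow_natCast, ← Real.rpow_mul (norm_nonneg _),
            ← Real.rpow_add_of_nonneg (norm_nonneg _) (by linarith) (by norm_num)]
          congr 1
          push_cast; ring
        rw [e]
        have := Real.rpow_le_rpow (norm_nonneg _) (hDJ x) (by linarith : 0 ≤ 2 * q - 2)
        gcongr
    _ = _ := by
        rw [integral_const_mul, h2]

/-- Fourier coefficients of the squared kernel count representations `i + j` with `i, j < 4M²`. For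
`M ≤ n < 2M` every `i < M²` gives one of `n²`, so each such frequency has weight at least `M²`. -/
lemma sum_coef_le_integral {s : ℝ} {M K : ℕ} (hs : 0 ≤ s) (hM : 1 ≤ M) (hK : 2 * M ≤ K) :
    (M : ℝ) ^ 3 * coef s (2 * M) ≤
      ∫ x : AddCircle (1 : ℝ), ‖∑ n ∈ Finset.Ico M K, (coef s n : ℂ) * fourier ((n : ℤ) ^ 2) x‖
        * ‖(∑ j ∈ Finset.range (4 * M ^ 2), (fourier (j : ℤ) x : ℂ)) ^ 2‖ ∂haarAddCircle := by
  set J := 4 * M ^ 2 with hJ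
  set R := Finset.range J with hR
  set u := truncLp 2 s M K with hu
  set v : L2Torus := ∑ a ∈ R ×ˢ R, (1 : ℂ) • fourierLp 2 ((a.1 : ℤ) + a.2) with hv
  have h1 : inner ℂ v u = ((∑ a ∈ R ×ˢ R, ∑ n ∈ Finset.Ico M K,
      coef s n * (if (a.1 : ℤ) + a.2 = (n : ℤ) ^ 2 then 1 else 0) : ℝ) : ℂ) := by
    push_cast
    rw [hv, sum_inner]
    refine Finset.sum_congr rfl fun a _ => ?_
    rw [hu, truncLp, inner_sum]
    refine Finset.sum_congr rfl fun n _ => ?_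
    rw [inner_smul_left, inner_smul_right, map_one, one_mul]
    congr 1
    rw [orthonormal_iff_ite.1 (orthonormal_fourier (T := (1 : ℝ))) ((a.1 : ℤ) + a.2) ((n : ℤ) ^ 2)]
    split_ifs <;> simp
  have h2 : (M : ℝ) ^ 3 * coef s (2 * M) ≤ ∑ a ∈ R ×ˢ R, ∑ n ∈ Finset.Ico M K,
      coef s n * (if (a.1 : ℤ) + a.2 = (n : ℤ) ^ 2 then 1 else 0) := by
    rw [Finset.sum_comm]
    calc (M : ℝ) ^ 3 * coef s (2 * M) = ∑ n ∈ Finset.Ico M (2 * M), coef s (2 * M) * (M : ℝ) ^ 2 := by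
          rw [Finset.sum_const, Nat.card_Ico, nsmul_eq_mul, show 2 * M - M = M by omega]
          ring
      _ ≤ ∑ n ∈ Finset.Ico M (2 * M), ∑ a ∈ R ×ˢ R,
          coef s n * (if (a.1 : ℤ) + a.2 = (n : ℤ) ^ 2 then 1 else 0) := by
          refine Finset.sum_le_sum fun n hn => ?_
          rw [Finset.mem_Ico] at hn
          rw [← Finset.mul_sum, Finset.sum_boole]
          have hcard : M ^ 2 ≤ ((R ×ˢ R).filter fun a : ℕ × ℕ => (a.1 : ℤ) + a.2 = (n : ℤ) ^ 2).card := by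
            rw [← Finset.card_range (M ^ 2)]
            apply Finset.card_le_card_of_injOn fun i => (i, n ^ 2 - i)
            · intro i hi
              rw [Finset.mem_coe, Finset.mem_range] at hi
              have b1 : M ^ 2 ≤ n ^ 2 := Nat.pow_le_pow_left hn.1 2
              have b2 : n ^ 2 < (2 * M) ^ 2 := Nat.pow_lt_pow_left hn.2 two_ne_zero
              rw [mul_pow] at b2
              simp only [Finset.coe_filter, Finset.mem_product, hR, hJ, Finset.mem_range,
                Set.mem_ofPred_eq]
              refine ⟨⟨by omega, by omega⟩, ?_⟩
              rw [Nat.cast_sub (by omega)]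
              push_cast
              ring
            · intro i _ j _ hij
              exact (Prod.mk.injEq _ _ _ _ ▸ hij).1
          have c1 := coef_anti hs (by omega) hn.2.le
          have c2 := coef_nonneg s n
          gcongr
          exact_mod_cast hcard
      _ ≤ _ := by
          apply Finset.sum_le_sum_of_subset_of_nonneg (Finset.Ico_subset_Ico_right hK)
          intro n _ _
          refine Finset.sum_nonneg fun a _ => mul_nonneg (coef_nonneg _ _) ?_
          split_ifs <;> norm_num
  refine h2.trans ?_
  have h3 : ‖inner ℂ v u‖ ≤ ∫ x, ‖v x‖ * ‖u x‖ ∂haarAddCircle := by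
    rw [L2.inner_def]
    refine (norm_integral_le_integral_norm _).trans ?_
    apply integral_mono_of_nonneg (Eventually.of_forall fun x => norm_nonneg _)
    · exact ((Lp.memLp v).norm.integrable_mul (Lp.memLp u).norm)
    · exact Eventually.of_forall fun x => norm_inner_le_norm _ _
  rw [h1, Complex.norm_real] at h3
  refine (le_abs_self _).trans (h3.trans (le_of_eq ?_))
  apply integral_congr_ae
  filter_upwards [coeFn_truncLp 2 s M K,
    coeFn_sum_fourierLp (P := 2) (R ×ˢ R) (fun _ => (1 : ℂ)) (fun a => (a.1 : ℤ) + a.2)] with x hx hy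
  rw [hx, hy, mul_comm]
  congr 2
  rw [sq, Finset.sum_mul_sum, Finset.sum_product]
  refine Finset.sum_congr rfl fun i _ => Finset.sum_congr rfl fun j _ => ?_
  rw [one_mul, fourier_add]

/-- Hölder against the squared kernel, whose dual norm is at most `J^(1+1/p)` with `J = 4M²`; the
power left is `3 - (2 + 2/p) = 1 - 2/p`. -/
lemma le_norm_truncLp_of_one_lt {p s : ℝ} (hp : 1 < p) (hs : 0 ≤ s) [Fact (1 ≤ ENNReal.ofReal p)]
    {M K : ℕ} (hM : 1 ≤ M) (hK : 2 * M ≤ K) :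
    2 ^ (-(2 * s)) / 4 ^ (1 + 1 / p) * (coef s M * (M : ℝ) ^ (1 - 2 / p))
      ≤ ‖truncLp (ENNReal.ofReal p) s M K‖ := by
  have hM' : (0 : ℝ) < M := by exact_mod_cast hM
  have hp0 : 0 < p := by linarith
  set q := p.conjExponent with hq
  have hpq : p.HolderConjugate q := Real.HolderConjugate.conjExponent hp
  set J := 4 * M ^ 2 with hJ
  have hJ' : (0 : ℝ) < J := by positivity
  set X := ‖truncLp (ENNReal.ofReal p) s M K‖ with hX
  have h1 := sum_coef_le_integral hs hM hK
  have h2 := integral_mul_norm_le_Lp_mul_Lq hpq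
    (memLp_of_continuous (f := fun x : AddCircle (1 : ℝ) =>
      ∑ n ∈ Finset.Ico M K, (coef s n : ℂ) * fourier ((n : ℤ) ^ 2) x) (by fun_prop) _)
    (memLp_of_continuous (f := fun x : AddCircle (1 : ℝ) =>
      (∑ j ∈ Finset.range J, (fourier (j : ℤ) x : ℂ)) ^ 2) (by fun_prop) _)
  have h3 : (∫ x : AddCircle (1 : ℝ), ‖∑ n ∈ Finset.Ico M K, (coef s n : ℂ) * fourier ((n : ℤ) ^ 2) x‖ ^ p
      ∂haarAddCircle) ^ (1 / p) = X := by
    rw [← Lp_norm_rpow_sum_fourierLp_ofReal hp0.le (Finset.Ico M K) (fun n => (coef s n : ℂ))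
      (fun n => (n : ℤ) ^ 2), ← Real.rpow_mul (norm_nonneg _), mul_one_div_cancel hp0.ne',
      Real.rpow_one]
    rfl
  have h4 : (∫ x : AddCircle (1 : ℝ), ‖(∑ j ∈ Finset.range J, (fourier (j : ℤ) x : ℂ)) ^ 2‖ ^ q
      ∂haarAddCircle) ^ (1 / q) ≤ (J : ℝ) ^ (1 + 1 / p) := by
    have hq0 : 0 < q := hpq.symm.pos
    have a1 := integral_dirichletKernel_sq_rpow_le hpq.symm.lt.le J
    have a2 := Real.rpow_le_rpow (integral_nonneg fun x => by positivity) a1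
      (by positivity : 0 ≤ 1 / q)
    refine a2.trans (le_of_eq ?_)
    rw [← Real.rpow_add_one hJ'.ne', ← Real.rpow_mul hJ'.le]
    congr 1
    have a3 := hpq.inv_add_inv_eq_one
    rw [one_div, one_div]
    have a4 : (2 * q - 2 + 1) * q⁻¹ = 2 - q⁻¹ := by field_simp; ring
    rw [a4]
    linarith
  rw [h3] at h2
  have h5 : (M : ℝ) ^ 3 * coef s (2 * M) ≤ X * (J : ℝ) ^ (1 + 1 / p) :=
    h1.trans (h2.trans (mul_le_mul_of_nonneg_left h4 (norm_nonneg _)))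
  rw [coef_mul] at h5
  have h6 : (J : ℝ) ^ (1 + 1 / p) = 4 ^ (1 + 1 / p) * (M : ℝ) ^ (2 + 2 / p) := by
    rw [hJ]
    push_cast
    rw [Real.mul_rpow (by norm_num) (by positivity), ← Real.rpow_natCast, ← Real.rpow_mul hM'.le]
    congr 2
    push_cast; ring
  have h7 : (M : ℝ) ^ 3 = (M : ℝ) ^ (1 - 2 / p) * (M : ℝ) ^ (2 + 2 / p) := by
    rw [← Real.rpow_add hM', ← Real.rpow_natCast]
    congr 1
    push_cast; ring
  rw [h6, h7] at h5
  have h8 : 0 < (M : ℝ) ^ (2 + 2 / p) := by positivity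
  rw [div_mul_eq_mul_div, div_le_iff₀ (by positivity)]
  refine le_of_mul_le_mul_right ?_ h8
  push_cast at h5
  linarith

/-! ### The flatness of high-pass filters -/

lemma fact_one_le_ofReal {p : ℝ} (hp : 1 ≤ p) : Fact (1 ≤ ENNReal.ofReal p) :=
  ⟨by rw [← ENNReal.ofReal_one]; exact ENNReal.ofReal_le_ofReal hp⟩

lemma isTheta_of_eventually_le {f g : ℕ → ℝ} {c C : ℝ} (hc : 0 < c) (hg : ∀ᶠ n in atTop, 0 ≤ g n)
    (h₁ : ∀ᶠ n in atTop, c * g n ≤ f n) (h₂ : ∀ᶠ n in atTop, f n ≤ C * g n) : f =Θ[atTop] g := by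
  constructor
  · apply IsBigO.of_bound C
    filter_upwards [hg, h₁, h₂] with n a b d
    rw [Real.norm_eq_abs, Real.norm_eq_abs, abs_of_nonneg a,
      abs_of_nonneg ((mul_nonneg hc.le a).trans b)]
    exact d
  · apply IsBigO.of_bound c⁻¹
    filter_upwards [hg, h₁] with n a b
    rw [Real.norm_eq_abs, Real.norm_eq_abs, abs_of_nonneg a,
      abs_of_nonneg ((mul_nonneg hc.le a).trans b), inv_mul_eq_div, le_div_iff₀ hc]
    linarith

lemma coef_pos (s : ℝ) {n : ℕ} (hn : 1 ≤ n) : 0 < coef s n := by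
  have : (0 : ℝ) < n := by exact_mod_cast hn
  unfold coef
  positivity

/-- The order of magnitude of the `L²` norm of the high-pass filter. -/
def l2Size (s : ℝ) (N : ℕ) : ℝ := coef s (cutoff N) * (cutoff N : ℝ) ^ (1 / 2 : ℝ)

lemma cutoff_cast_pos (N : ℕ) : (0 : ℝ) < cutoff N := by exact_mod_cast one_le_cutoff N

lemma l2Size_pos (s : ℝ) (N : ℕ) : 0 < l2Size s N :=
  mul_pos (coef_pos s (one_le_cutoff N)) (Real.rpow_pos_of_pos (cutoff_cast_pos N) _)

lemma normLp_two_highPass_pos {s : ℝ} (hs : 1 / 4 < s) (N : ℕ) :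
    0 < normLp 2 (highPass (riemannFn s) N) :=
  lt_of_lt_of_le (mul_pos (by positivity) (l2Size_pos s N)) (le_normLp_two_highPass hs N)

lemma exists_normLp_highPass_le_of_lt_four {p s : ℝ} (hp : 2 < p) (hp4 : p < 4) (hs : 1 / 4 < s) :
    ∃ C, 0 ≤ C ∧ ∀ N : ℕ, normLp p (highPass (riemannFn s) N) ≤ C * l2Size s N := by
  have hs' : sStar p < s := by unfold sStar; rwa [if_pos hp4.le]
  obtain ⟨C, hC, h⟩ := exists_normLp_highPass_le hp hs'
  refine ⟨C, hC, fun N => (h N).trans (le_of_eq ?_)⟩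
  rw [growth, lengthExp, logExp, if_pos hp4.le, if_neg hp4.ne, Real.rpow_zero, mul_one, l2Size]

/-- The Weyl bounds need an exponent above `2`, so the `L²` bound is inherited from `L³`; any
exponent strictly between `2` and `4` would serve. -/
lemma exists_normLp_two_highPass_le {s : ℝ} (hs : 1 / 4 < s) :
    ∃ C, 0 < C ∧ ∀ N : ℕ, normLp 2 (highPass (riemannFn s) N) ≤ C * l2Size s N := by
  have hs' : sStar 3 < s := by unfold sStar; rwa [if_pos (by norm_num)]
  obtain ⟨C, hC, h⟩ := exists_normLp_highPass_le_of_lt_four (p := 3) (by norm_num) (by norm_num) hs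
  have := fact_one_le_ofReal (p := 3) (by norm_num)
  have h2 : ∀ N : ℕ, normLp 2 (highPass (riemannFn s) N) ≤ C * l2Size s N := fun N =>
    (normLp_mono (by norm_num) (memLp_highPass_and_tendsto (by norm_num) hs' N).1).trans (h N)
  refine ⟨C, ?_, h2⟩
  have h3 := (normLp_two_highPass_pos hs 0).trans_le (h2 0)
  exact pos_of_mul_pos_left h3 (l2Size_pos s 0).le

lemma normLp_nonneg (p : ℝ) (f : AddCircle (1 : ℝ) → ℂ) : 0 ≤ normLp p f := ENNReal.toReal_nonneg

lemma flatnessHP_eq (f : L2Torus) (p : ℝ) (N : ℕ) :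
    flatnessHP f p N = (normLp p (highPass f N) / normLp 2 (highPass f N)) ^ p := by
  rw [flatnessHP, Real.div_rpow (normLp_nonneg _ _) (normLp_nonneg _ _)]

lemma flatnessHP_le {p s C X : ℝ} (hp : 0 ≤ p) (hs : 1 / 4 < s) (N : ℕ)
    (h : normLp p (highPass (riemannFn s) N) ≤ C * (l2Size s N * X)) :
    flatnessHP (riemannFn s) p N ≤ (C / 2 ^ (-(2 * s)) * X) ^ p := by
  rw [flatnessHP_eq]
  apply Real.rpow_le_rpow (div_nonneg (normLp_nonneg _ _) (normLp_nonneg _ _)) _ hp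
  have h2 := le_normLp_two_highPass hs N
  have hl := l2Size_pos s N
  have hc : (0 : ℝ) < 2 ^ (-(2 * s)) := by positivity
  have h0 : 0 ≤ C * X := by
    have := (normLp_nonneg _ _).trans h
    rw [mul_left_comm] at this
    exact nonneg_of_mul_nonneg_right this hl
  change 2 ^ (-(2 * s)) * l2Size s N ≤ _ at h2
  rw [div_le_iff₀ (normLp_two_highPass_pos hs N)]
  calc _ ≤ _ := h
    _ = C * X / 2 ^ (-(2 * s)) * (2 ^ (-(2 * s)) * l2Size s N) := by field_simp
    _ ≤ C * X / 2 ^ (-(2 * s)) * normLp 2 (highPass (riemannFn s) N) := by gcongr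
    _ = _ := by ring

lemma memLp_highPass {p s : ℝ} (hs : sStar p < s) (N : ℕ) :
    MemLp (highPass (riemannFn s) N) (ENNReal.ofReal p) haarAddCircle := by
  rcases le_or_gt p 3 with h | h
  · have hs' : sStar 3 < s := by
      unfold sStar at hs ⊢
      rw [if_pos (by linarith)] at hs
      rwa [if_pos (by norm_num)]
    have := fact_one_le_ofReal (p := 3) (by norm_num)
    exact (memLp_highPass_and_tendsto (by norm_num) hs' N).1.mono_exponent
      (ENNReal.ofReal_le_ofReal h)
  · have := fact_one_le_ofReal (p := p) (by linarith)
    exact (memLp_highPass_and_tendsto (by linarith) hs N).1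

lemma one_quarter_lt_of_sStar_lt {p s : ℝ} (hs : sStar p < s) : 1 / 4 < s := by
  unfold sStar at hs
  split_ifs at hs with h4
  · exact hs
  · push Not at h4
    have : 1 / p ≤ 1 / 4 := by rw [div_le_div_iff₀ (by linarith) (by norm_num)]; linarith
    linarith

/-- Flatness is at least `1` on a probability space. Above, `max p 3` replaces `p` so that `p = 2`
is included. -/
lemma isTheta_flatnessHP_of_lt_four {p s : ℝ} (hp : 2 ≤ p) (hp4 : p < 4) (hs : sStar p < s) :
    (fun N : ℕ => flatnessHP (riemannFn s) p N) =Θ[atTop] fun _ => (1 : ℝ) := by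
  have hs4 := one_quarter_lt_of_sStar_lt hs
  have hr : max p 3 < 4 := max_lt hp4 (by norm_num)
  have hr2 : 2 < max p 3 := lt_of_lt_of_le (by norm_num) (le_max_right _ _)
  obtain ⟨C, hC, h⟩ := exists_normLp_highPass_le_of_lt_four hr2 hr hs4
  have hs' : sStar (max p 3) < s := by unfold sStar; rwa [if_pos hr.le]
  apply isTheta_of_eventually_le (c := 1) (C := (C / 2 ^ (-(2 * s)) * 1) ^ p) one_pos
    (Eventually.of_forall fun _ => zero_le_one)
  · refine Eventually.of_forall fun N => ?_
    rw [mul_one, flatnessHP_eq]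
    apply Real.one_le_rpow _ (by linarith)
    rw [one_le_div (normLp_two_highPass_pos hs4 N)]
    exact normLp_mono hp (memLp_highPass hs N)
  · refine Eventually.of_forall fun N => ?_
    rw [mul_one]
    apply flatnessHP_le (by linarith) hs4
    rw [mul_one]
    exact (normLp_mono (le_max_left _ _) (memLp_highPass hs' N)).trans (h N)

lemma isTheta_flatnessHP_four {s : ℝ} (hs : sStar 4 < s) :
    (fun N : ℕ => flatnessHP (riemannFn s) 4 N) =Θ[atTop] fun N => Real.log N := by
  have hs4 := one_quarter_lt_of_sStar_lt hs
  have := fact_one_le_ofReal (p := 4) (by norm_num)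
  obtain ⟨C, hC, h⟩ := exists_normLp_highPass_le (by norm_num) hs
  obtain ⟨C₂, hC₂, h₂⟩ := exists_normLp_two_highPass_le hs4
  have hlow : ∀ N : ℕ, 4 ≤ cutoff N → (7 ^ (-(2 * s)) * coef s (cutoff N)) ^ 4 *
      ((cutoff N : ℝ) ^ 2 * Real.log (cutoff N) / 64)
      ≤ normLp 4 (highPass (riemannFn s) N) ^ (4 : ℝ) := by
    intro N hN
    have ht := (memLp_highPass_and_tendsto (by norm_num) hs N).2
    refine ge_of_tendsto (ht.rpow_const (Or.inr (by norm_num))) ?_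
    filter_upwards [eventually_ge_atTop (7 * cutoff N)] with K hK
    exact le_norm_truncLp_four (by linarith) hN hK
  apply isTheta_of_eventually_le (c := (7 ^ (-(2 * s)) / C₂) ^ 4 / 128)
    (C := (C / 2 ^ (-(2 * s))) ^ 4 * 2) (by positivity)
    (Eventually.of_forall fun N => Real.log_natCast_nonneg N)
  · filter_upwards [tendsto_cutoff.eventually_ge_atTop 4, eventually_ge_atTop 1] with N hN hN1
    have hM := cutoff_cast_pos N
    have hN0 : (0 : ℝ) < N := by exact_mod_cast hN1
    have hc := coef_pos s (one_le_cutoff N)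
    -- Only `N ≤ (cutoff N)²` is used; the square costs the factor `2` that turns `64` into `128`.
    have hlog : Real.log N / 2 ≤ Real.log (cutoff N) := by
      have h1 : Real.log N ≤ Real.log ((cutoff N : ℝ) ^ 2) :=
        Real.log_le_log hN0 (by exact_mod_cast le_cutoff_sq)
      rw [Real.log_pow] at h1
      push_cast at h1
      linarith
    have h2 := normLp_two_highPass_pos hs4 N
    rw [flatnessHP, le_div_iff₀ (Real.rpow_pos_of_pos h2 _)]
    refine le_trans ?_ (hlow N hN)
    have h3 : normLp 2 (highPass (riemannFn s) N) ^ (4 : ℝ)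
        ≤ C₂ ^ 4 * (coef s (cutoff N) ^ 4 * (cutoff N : ℝ) ^ 2) := by
      rw [Real.rpow_ofNat]
      calc _ ≤ (C₂ * l2Size s N) ^ 4 := by
            gcongr
            exact h₂ N
        _ = C₂ ^ 4 * (coef s (cutoff N) ^ 4 * ((cutoff N : ℝ) ^ (1 / 2 : ℝ)) ^ 4) := by
            rw [l2Size]; ring
        _ = _ := by
            rw [← Real.rpow_natCast ((cutoff N : ℝ) ^ (1 / 2 : ℝ)), ← Real.rpow_mul hM.le]
            norm_num
    have hl0 : 0 ≤ Real.log N := Real.log_natCast_nonneg N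
    calc (7 ^ (-(2 * s)) / C₂) ^ 4 / 128 * Real.log N * normLp 2 (highPass (riemannFn s) N) ^ (4 : ℝ)
        ≤ (7 ^ (-(2 * s)) / C₂) ^ 4 / 128 * Real.log N
          * (C₂ ^ 4 * (coef s (cutoff N) ^ 4 * (cutoff N : ℝ) ^ 2)) := by gcongr
      _ = (7 ^ (-(2 * s)) * coef s (cutoff N)) ^ 4 * ((cutoff N : ℝ) ^ 2 * (Real.log N / 2) / 64) := by
          field_simp
          ring
      _ ≤ _ := by gcongr
  · filter_upwards [eventually_ge_atTop 4] with N hN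
    have hM := cutoff_cast_pos N
    have hM1 : (1 : ℝ) ≤ cutoff N := by exact_mod_cast one_le_cutoff N
    have hN4 : (4 : ℝ) ≤ N := by exact_mod_cast hN
    have hlM := Real.log_nonneg hM1
    have h1 := flatnessHP_le (p := 4) (C := C) (X := (1 + Real.log (cutoff N)) ^ (1 / 4 : ℝ))
      (by norm_num) hs4 N ((h N).trans (le_of_eq (by
        rw [growth, lengthExp, logExp, if_pos le_rfl, if_pos rfl, l2Size]; ring)))
    refine h1.trans ?_
    rw [Real.mul_rpow (by positivity) (by positivity), ← Real.rpow_mul (by positivity),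
      Real.rpow_ofNat, mul_assoc]
    norm_num
    have h2 : 1 + Real.log (cutoff N) ≤ 2 * Real.log N := by
      have a1 : Real.log ((cutoff N : ℝ) ^ 2) ≤ Real.log (4 * N) :=
        Real.log_le_log (by positivity) (by exact_mod_cast cutoff_sq_le (by omega))
      rw [Real.log_pow, Real.log_mul (by norm_num) (by linarith)] at a1
      have a2 : Real.log 4 ≤ Real.log N := Real.log_le_log (by norm_num) hN4
      have a3 : 1 ≤ Real.log 4 := by
        rw [show (4 : ℝ) = 2 ^ 2 by norm_num, Real.log_pow]
        have := Real.log_two_gt_d9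
        push_cast; linarith
      push_cast at a1
      linarith
    gcongr

lemma isTheta_flatnessHP_of_four_lt {p s : ℝ} (hp : 4 < p) (hs : sStar p < s) :
    (fun N : ℕ => flatnessHP (riemannFn s) p N) =Θ[atTop] fun N => (N : ℝ) ^ (p / 4 - 1) := by
  have hs4 := one_quarter_lt_of_sStar_lt hs
  have hp0 : 0 < p := by linarith
  have := fact_one_le_ofReal (p := p) (by linarith)
  obtain ⟨C, hC, h⟩ := exists_normLp_highPass_le (by linarith) hs
  obtain ⟨C₂, hC₂, h₂⟩ := exists_normLp_two_highPass_le hs4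
  set c : ℝ := 2 ^ (-(2 * s)) / 4 ^ (1 + 1 / p) with hc
  have hc0 : 0 < c := by positivity
  have hsplit : ∀ N : ℕ, (cutoff N : ℝ) ^ (1 - 2 / p)
      = (cutoff N : ℝ) ^ (1 / 2 : ℝ) * (cutoff N : ℝ) ^ (1 / 2 - 2 / p) := by
    intro N
    rw [← Real.rpow_add (cutoff_cast_pos N)]
    congr 1; ring
  -- The ratio of the `L^p` and `L²` sizes is `M^(1/2-2/p)`; its `p`-th power is `(M²)^(p/4-1)`, and
  -- `M²` is comparable to `N`.
  have hpow : ∀ N : ℕ, ((cutoff N : ℝ) ^ (1 / 2 - 2 / p)) ^ p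
      = ((cutoff N : ℝ) ^ 2) ^ (p / 4 - 1) := by
    intro N
    have hM := cutoff_cast_pos N
    rw [← Real.rpow_natCast, ← Real.rpow_mul hM.le, ← Real.rpow_mul hM.le]
    congr 1
    push_cast
    field_simp
    ring
  have hlow : ∀ N : ℕ, c * (coef s (cutoff N) * (cutoff N : ℝ) ^ (1 - 2 / p))
      ≤ normLp p (highPass (riemannFn s) N) := by
    intro N
    refine ge_of_tendsto (memLp_highPass_and_tendsto (by linarith) hs N).2 ?_
    filter_upwards [eventually_ge_atTop (2 * cutoff N)] with K hK
    exact le_norm_truncLp_of_one_lt (by linarith) (by linarith) (one_le_cutoff N) hK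
  apply isTheta_of_eventually_le (c := (c / C₂) ^ p)
    (C := (C / 2 ^ (-(2 * s))) ^ p * 4 ^ (p / 4 - 1)) (by positivity)
    (Eventually.of_forall fun N => by positivity)
  · refine Eventually.of_forall fun N => ?_
    have hM := cutoff_cast_pos N
    have h2 := normLp_two_highPass_pos hs4 N
    rw [flatnessHP_eq]
    calc (c / C₂) ^ p * (N : ℝ) ^ (p / 4 - 1)
        ≤ (c / C₂) ^ p * ((cutoff N : ℝ) ^ (1 / 2 - 2 / p)) ^ p := by
          rw [hpow]
          have : (N : ℝ) ≤ (cutoff N : ℝ) ^ 2 := by exact_mod_cast le_cutoff_sq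
          have : 0 ≤ p / 4 - 1 := by linarith
          gcongr
      _ = (c / C₂ * (cutoff N : ℝ) ^ (1 / 2 - 2 / p)) ^ p :=
          (Real.mul_rpow (by positivity) (by positivity)).symm
      _ ≤ _ := by
          apply Real.rpow_le_rpow (by positivity) _ hp0.le
          rw [le_div_iff₀ h2]
          calc _ ≤ c / C₂ * (cutoff N : ℝ) ^ (1 / 2 - 2 / p) * (C₂ * l2Size s N) := by
                gcongr; exact h₂ N
            _ = c * (coef s (cutoff N) * (cutoff N : ℝ) ^ (1 - 2 / p)) := by
                rw [hsplit, l2Size]; field_simp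
            _ ≤ _ := hlow N
  · filter_upwards [eventually_ge_atTop 1] with N hN
    have hM := cutoff_cast_pos N
    have h1 := flatnessHP_le (p := p) (C := C) (X := (cutoff N : ℝ) ^ (1 / 2 - 2 / p))
      hp0.le hs4 N ((h N).trans (le_of_eq (by
        rw [growth, lengthExp, logExp, if_neg (by linarith), if_neg hp.ne', Real.rpow_zero,
          hsplit, l2Size]; ring)))
    refine h1.trans ?_
    rw [Real.mul_rpow (by positivity) (by positivity), hpow, mul_assoc,
      ← Real.mul_rpow (by norm_num) (by positivity)]
    have a1 : ((cutoff N : ℝ)) ^ 2 ≤ 4 * N := by exact_mod_cast cutoff_sq_le hN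
    have : 0 ≤ p / 4 - 1 := by linarith
    gcongr

end

theorem theoremA (p s : ℝ) (hp : 2 ≤ p) (hs : sStar p < s) :
    MemLp (riemannFn s) (ENNReal.ofReal p) haarAddCircle ∧
    (∀ N : ℕ, MemLp (highPass (riemannFn s) N) (ENNReal.ofReal p) haarAddCircle) ∧
    (p < 4 → (fun N : ℕ => flatnessHP (riemannFn s) p N) =Θ[atTop] fun _ => (1 : ℝ)) ∧
    (p = 4 → (fun N : ℕ => flatnessHP (riemannFn s) p N) =Θ[atTop] fun N => Real.log N) ∧
    (4 < p → (fun N : ℕ => flatnessHP (riemannFn s) p N) =Θ[atTop]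
      fun N => (N : ℝ) ^ (p / 4 - 1)) := by
  refine ⟨?_, memLp_highPass hs, fun h => isTheta_flatnessHP_of_lt_four hp h hs, ?_,
    fun h => isTheta_flatnessHP_of_four_lt h hs⟩
  · have h := memLp_highPass hs 0
    rwa [highPass_zero] at h
  · rintro rfl
    exact isTheta_flatnessHP_four hs
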